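/- All graphs are finite and simple. Let $G$ be a graph without isolated vertices. A threshold weighting on $G$ is a pair $\Delta=(\alpha,\beta)\in[0,1]^{V(G)}\times[0,2]^{E(G)}$ such that, writing $\Delta(H)=\sum_{u\in V(H)}\alpha(u)-\sum_{e\in E(H)}\beta(e)$ for a subgraph $H$ of $G$, one has $\Delta(H)\ge 0$ for all $H\subseteq G$ and $\Delta(G)=0$; let $\theta(G)$ be the set of threshold weightings. A union sequence of $G$ is a sequence $(H_1,\dots,H_k)$ of distinct subgraphs of $G$ such that $H_k=G$ and each $H_i$ is either a single edge or the union of two previous graphs in the sequence; let $\mathrm{Seq}(G)$ be the set of union sequences. Define $$\kappa_\Delta(G)=\min_{S\in\mathrm{Seq}(G)}\max_{H\in S}\Delta(H),\qquad \kappa(G)=\max_{\Delta\in\theta(G)}\kappa_\Delta(G).$$ Let $\mathrm{tw}(G)$ denote the treewidth of $G$. For $q\ge 2$ and $d\ge 1$ let $K_q^d$ be the Hamming graph with vertex set $[q]^d$, in which two vertices are adjacent if and only if they differ in exactly one coordinate, and let $Q_d=K_2^d$ be the hypercube. **Theorem.** There are absolute constants $c,C>0$ such that the following hold. 1. For all $q\ge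 2$ and $d\ge 1$, $\kappa(K_q^d)\le C\,q^d/d$; and if moreover $(q,d)\ne(2,1)$, then $\kappa(K_q^d)\ge c\,q^d/d$. That is, $\kappa(K_q^d)=\Theta(q^d/d)$ uniformly in $q$ and $d$. 2. For all $q\ge 2$ and $d\ge 1$, $c\,q^d/\sqrt d\le \mathrm{tw}(K_q^d)\le C\,q^d/\sqrt d$. 3. For all $d\ge 2$, $$c\,\frac{\mathrm{tw}(Q_d)}{\sqrt{\log \mathrm{tw}(Q_d)}}\le\kappa(Q_d)\le C\,\frac{\mathrm{tw}(Q_d)}{\sqrt{\log \mathrm{tw}(Q_d)}}.$$ In particular $\kappa$ is separated from treewidth: $\kappa(Q_d)=o(\mathrm{tw}(Q_d))$ as $d\to\infty$. -/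

import Mathlib

open Classical in
/-- The weight `Δ(H) = α(H) - β(H)` of a subgraph `H`, for `Δ = (α, β)`: the sum of `α` over the
vertices of `H` minus the sum of `β` over the edges of `H`. -/
noncomputable def subgraphWeight {V : Type*} [Fintype V] {G : SimpleGraph V}
    (Δ : (V → ℝ) × (Sym2 V → ℝ)) (H : G.Subgraph) : ℝ :=
  ∑ u ∈ H.verts.toFinset, Δ.1 u - ∑ e ∈ H.edgeSet.toFinset, Δ.2 e

/-- `θ(G)`, the set of threshold weightings `Δ = (α, β)` on `G`. An edge weighting is represented
by a function on all unordered pairs that vanishes on the pairs that are not edges. -/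
def thresholdWeightings {V : Type*} [Fintype V] (G : SimpleGraph V) :
    Set ((V → ℝ) × (Sym2 V → ℝ)) :=
  {Δ | (∀ u, Δ.1 u ∈ Set.Icc (0 : ℝ) 1) ∧
    (∀ e ∈ G.edgeSet, Δ.2 e ∈ Set.Icc (0 : ℝ) 2) ∧
    (∀ e ∉ G.edgeSet, Δ.2 e = 0) ∧
    (∀ H : G.Subgraph, 0 ≤ subgraphWeight Δ H) ∧
    subgraphWeight Δ (⊤ : G.Subgraph) = 0}

/-- Every member of the list of subgraphs is a single edge (with its two endpoints) or the union of
two earlier members. -/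
def BuiltByUnions {V : Type*} (G : SimpleGraph V) (S : List G.Subgraph) : Prop :=
  ∀ (i : ℕ) (hi : i < S.length),
    (∃ (u v : V) (h : G.Adj u v), S[i] = G.subgraphOfAdj h) ∨
    (∃ (j k : ℕ) (hj : j < i) (hk : k < i), S[i] = S[j] ⊔ S[k])

/-- Union sequences of `G`: lists of distinct subgraphs of `G` that end in `G` itself, each member
of which is an edge or the union of two earlier members. -/
def IsUnionSequence {V : Type*} (G : SimpleGraph V) (S : List G.Subgraph) : Prop :=
  S.Nodup ∧ S.getLast? = some ⊤ ∧ BuiltByUnions G S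

/-- The possible values of `max_{H ∈ S} Δ(H)`, where `S` ranges over the union sequences of `G`. -/
def unionSequenceCosts {V : Type*} [Fintype V] (G : SimpleGraph V)
    (Δ : (V → ℝ) × (Sym2 V → ℝ)) : Set ℝ :=
  {m | ∃ S : List G.Subgraph, IsUnionSequence G S ∧
    IsGreatest {x | ∃ H ∈ S, x = subgraphWeight Δ H} m}

/-- `κ_Δ(G) = min_S max_{H ∈ S} Δ(H)` over the union sequences `S` of `G`. The minimum is attained
if `G` is a nonempty finite graph without isolated vertices: see `kappaAt_isLeast`. -/
noncomputable def kappaAt {V : Type*} [Fintype V] (G : SimpleGraph V)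
    (Δ : (V → ℝ) × (Sym2 V → ℝ)) : ℝ :=
  sInf (unionSequenceCosts G Δ)

/-- `κ(G) = max_Δ κ_Δ(G)` over the threshold weightings `Δ` on `G`. The maximum is attained
if `G` is a nonempty finite graph without isolated vertices: see `kappa_isGreatest`. -/
noncomputable def kappa {V : Type*} [Fintype V] (G : SimpleGraph V) : ℝ :=
  sSup (kappaAt G '' thresholdWeightings G)

/-- The Hamming graph `K_q^d`: words of length `d` over an alphabet of `q` letters, two of them
adjacent if they differ in exactly one coordinate. -/
def hammingGraph (q d : ℕ) : SimpleGraph (Fin d → Fin q) where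
  Adj x y := hammingDist x y = 1
  symm := ⟨fun x y h => by rw [hammingDist_comm]; exact h⟩
  loopless := ⟨fun x h => by simp at h⟩

/-- A tree decomposition of `G`: a finite tree `T` with a bag of vertices of `G` at each node, such
that each edge of `G` lies in some bag and for each vertex `v` of `G` the nodes whose bags
contain `v` induce a connected (in particular nonempty) subgraph of `T`. -/
structure TreeDecomposition {V : Type*} (G : SimpleGraph V) where
  size : ℕ
  tree : SimpleGraph (Fin size)
  isTree : tree.IsTree
  bag : Fin size → Finset V
  edge_mem : ∀ u v, G.Adj u v → ∃ t, u ∈ bag t ∧ v ∈ bag t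
  connected : ∀ v, (tree.induce {t | v ∈ bag t}).Connected

/-- The width of a tree decomposition: one less than the size of the largest bag. (If `G` has a
vertex then there is a nonempty bag, so the subtraction does not truncate.) -/
def TreeDecomposition.width {V : Type*} {G : SimpleGraph V} (D : TreeDecomposition G) : ℕ :=
  Finset.univ.sup (fun t => (D.bag t).card) - 1

/-- The treewidth of a finite graph: the minimum width of a tree decomposition. -/
noncomputable def treewidth {V : Type*} [Fintype V] (G : SimpleGraph V) : ℕ :=
  sInf (Set.range fun D : TreeDecomposition G => D.width)

/-- A finite graph has a tree decomposition, so the minimum in `treewidth` is attained. -/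
theorem treeDecomposition_nonempty {V : Type*} [Fintype V] (G : SimpleGraph V) :
    Nonempty (TreeDecomposition G) := by
  refine ⟨⟨1, ⊤, ?_, fun _ => Finset.univ, fun _ _ _ => ⟨0, by simp⟩, fun v => ?_⟩⟩
  · exact SimpleGraph.IsTree.of_subsingleton
  · have : Nonempty {t : Fin 1 | v ∈ (Finset.univ : Finset V)} := ⟨⟨0, by simp⟩⟩
    exact ⟨SimpleGraph.Preconnected.of_subsingleton⟩

theorem exists_isUnionSequence {V : Type*} [Fintype V] [Nonempty V] (G : SimpleGraph V)
    (hG : ∀ u, ∃ v, G.Adj u v) : ∃ S, IsUnionSequence G S := by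
  classical
  have hfin : {S : List G.Subgraph | S.Nodup ∧ BuiltByUnions G S}.Finite := by
    refine (List.finite_length_le G.Subgraph (Fintype.card G.Subgraph)).subset ?_
    rintro S ⟨hS, -⟩
    exact hS.length_le_card
  obtain ⟨S, ⟨hS, hB⟩, hmax⟩ := hfin.exists_maximalFor List.length _
    ⟨[], by simp, fun i hi => by simp at hi⟩
  have hext : ∀ H : G.Subgraph, ((∃ (u v : V) (h : G.Adj u v), H = G.subgraphOfAdj h) ∨
      (∃ A ∈ S, ∃ B ∈ S, H = A ⊔ B)) → H ∈ S := by
    intro H hH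
    by_contra hn
    have hmem : S ++ [H] ∈ {S : List G.Subgraph | S.Nodup ∧ BuiltByUnions G S} := by
      refine ⟨?_, ?_⟩
      · rw [List.nodup_append]
        refine ⟨hS, by simp, ?_⟩
        intro a ha b hb hab
        simp only [List.mem_singleton] at hb
        exact hn (hb ▸ hab ▸ ha)
      · intro i hi
        simp only [List.length_append, List.length_singleton] at hi
        rcases Nat.lt_succ_iff_lt_or_eq.1 hi with hi' | rfl
        · rcases hB i hi' with h | ⟨j, k, hj, hk, h⟩
          · left
            simpa [List.getElem_append_left hi'] using h
          · right
            refine ⟨j, k, hj, hk, ?_⟩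
            rw [List.getElem_append_left hi', List.getElem_append_left (hj.trans hi'),
              List.getElem_append_left (hk.trans hi'), h]
        · rcases hH with h | ⟨A, hA, B, hB', h⟩
          · left
            simpa using h
          · right
            obtain ⟨j, hj, rfl⟩ := List.getElem_of_mem hA
            obtain ⟨k, hk, rfl⟩ := List.getElem_of_mem hB'
            refine ⟨j, k, hj, hk, ?_⟩
            rw [List.getElem_append_left hj, List.getElem_append_left hk]
            simpa using h
    have := hmax hmem (by simp)
    simp at this
  have hsup : ∀ (s : Finset G.Subgraph), s.Nonempty →
      (∀ H ∈ s, ∃ (u v : V) (h : G.Adj u v), H = G.subgraphOfAdj h) → s.sup id ∈ S := by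
    intro s hs
    induction hs using Finset.Nonempty.cons_induction with
    | singleton a => intro h; simpa using hext a (Or.inl (h a (by simp)))
    | cons a s ha hs ih =>
      intro h
      rw [Finset.sup_cons]
      refine hext _ (Or.inr ⟨a, hext a (Or.inl (h a (by simp))), _, ih fun H hH => ?_, rfl⟩)
      exact h H (by simp [hH])
  have htop : (⊤ : G.Subgraph) ∈ S := by
    set s : Finset G.Subgraph :=
      Finset.univ.filter fun H => ∃ (u v : V) (h : G.Adj u v), H = G.subgraphOfAdj h with hs
    have hle : ∀ (u v : V) (h : G.Adj u v), G.subgraphOfAdj h ≤ s.sup id := by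
      intro u v h
      exact Finset.le_sup (f := id) (b := G.subgraphOfAdj h)
        (by simp only [hs, Finset.mem_filter, Finset.mem_univ, true_and]; exact ⟨u, v, h, rfl⟩)
    have hne : s.Nonempty := by
      obtain ⟨u⟩ := ‹Nonempty V›
      obtain ⟨v, h⟩ := hG u
      exact ⟨G.subgraphOfAdj h, by
        simp only [hs, Finset.mem_filter, Finset.mem_univ, true_and]; exact ⟨u, v, h, rfl⟩⟩
    have heq : s.sup id = ⊤ := by
      refine top_le_iff.1 ⟨fun u _ => ?_, fun u v h => ?_⟩
      · obtain ⟨v, h⟩ := hG u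
        exact (hle u v h).1 (by simp)
      · have h' : G.Adj u v := by simpa using h
        exact (hle u v h').2 (by simp)
    rw [← heq]
    exact hsup s hne (by simp [hs])
  obtain ⟨n, hn, hS'⟩ := List.getElem_of_mem htop
  refine ⟨S.take (n + 1), hS.sublist (List.take_sublist _ _), ?_, ?_⟩
  · rw [List.getLast?_eq_getElem?]
    have : (S.take (n + 1)).length - 1 = n := by
      rw [List.length_take]; omega
    rw [this, List.getElem?_take_of_lt (by omega), List.getElem?_eq_getElem hn, hS']
  · intro i hi
    rw [List.length_take] at hi
    rcases hB i (by omega) with h | ⟨j, k, hj, hk, h⟩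
    · left; simpa using h
    · right
      refine ⟨j, k, hj, hk, ?_⟩
      simpa using h

theorem unionSequenceCosts_finite {V : Type*} [Fintype V] (G : SimpleGraph V)
    (Δ : (V → ℝ) × (Sym2 V → ℝ)) : (unionSequenceCosts G Δ).Finite := by
  refine (Set.finite_range fun H : G.Subgraph => subgraphWeight Δ H).subset ?_
  rintro m ⟨S, -, ⟨H, -, h⟩, -⟩
  exact ⟨H, h.symm⟩

theorem exists_isGreatest_cost {V : Type*} [Fintype V] {G : SimpleGraph V} {S : List G.Subgraph}
    (hS : IsUnionSequence G S) (Δ : (V → ℝ) × (Sym2 V → ℝ)) :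
    ∃ m, IsGreatest {x | ∃ H ∈ S, x = subgraphWeight Δ H} m := by
  have hmem : (⊤ : G.Subgraph) ∈ S := List.mem_of_getLast? hS.2.1
  have hfin : {x | ∃ H ∈ S, x = subgraphWeight Δ H}.Finite := by
    refine (Set.finite_range fun H : G.Subgraph => subgraphWeight Δ H).subset ?_
    rintro m ⟨H, -, h⟩
    exact ⟨H, h.symm⟩
  exact ⟨_, hfin.isCompact.isGreatest_sSup ⟨_, ⊤, hmem, rfl⟩⟩

/-- The minimum in the definition of `κ_Δ(G)` is attained. -/
theorem kappaAt_isLeast {V : Type*} [Fintype V] [Nonempty V] (G : SimpleGraph V)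
    (hG : ∀ u, ∃ v, G.Adj u v) (Δ : (V → ℝ) × (Sym2 V → ℝ)) :
    IsLeast (unionSequenceCosts G Δ) (kappaAt G Δ) := by
  obtain ⟨S, hS⟩ := exists_isUnionSequence G hG
  obtain ⟨m, hm⟩ := exists_isGreatest_cost hS Δ
  exact (unionSequenceCosts_finite G Δ).isCompact.isLeast_sInf ⟨m, S, hS, hm⟩

theorem continuous_subgraphWeight {V : Type*} [Fintype V] {G : SimpleGraph V} (H : G.Subgraph) :
    Continuous fun Δ : (V → ℝ) × (Sym2 V → ℝ) => subgraphWeight Δ H := by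
  unfold subgraphWeight
  fun_prop

theorem isCompact_thresholdWeightings {V : Type*} [Fintype V] (G : SimpleGraph V) :
    IsCompact (thresholdWeightings G) := by
  have hK : IsCompact ((Set.univ.pi fun _ : V => Set.Icc (0 : ℝ) 1) ×ˢ
      (Set.univ.pi fun _ : Sym2 V => Set.Icc (0 : ℝ) 2)) :=
    (isCompact_univ_pi fun _ => isCompact_Icc).prod (isCompact_univ_pi fun _ => isCompact_Icc)
  refine hK.of_isClosed_subset ?_ ?_
  · have h1 : ∀ u : V, Continuous fun Δ : (V → ℝ) × (Sym2 V → ℝ) => Δ.1 u := by fun_prop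
    have h2 : ∀ e : Sym2 V, Continuous fun Δ : (V → ℝ) × (Sym2 V → ℝ) => Δ.2 e := by fun_prop
    simp only [thresholdWeightings, Set.ofPred_and, Set.ofPred_forall]
    refine (isClosed_iInter fun u => isClosed_Icc.preimage (h1 u)).inter
      ((isClosed_iInter fun e => isClosed_iInter fun _ => isClosed_Icc.preimage (h2 e)).inter
      ((isClosed_iInter fun e => isClosed_iInter fun _ => isClosed_eq (h2 e) continuous_const).inter
      ((isClosed_iInter fun H => isClosed_le continuous_const (continuous_subgraphWeight H)).inter
      (isClosed_eq (continuous_subgraphWeight _) continuous_const))))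
  · rintro Δ ⟨ha, hb, hc, -, -⟩
    refine ⟨fun u _ => ha u, fun e _ => ?_⟩
    by_cases he : e ∈ G.edgeSet
    · exact hb e he
    · simp [hc e he]

/-- The maximum in the definition of `κ(G)` is attained. -/
theorem kappa_isGreatest {V : Type*} [Fintype V] [Nonempty V] (G : SimpleGraph V)
    (hG : ∀ u, ∃ v, G.Adj u v) :
    IsGreatest (kappaAt G '' thresholdWeightings G) (kappa G) := by
  have hne : (thresholdWeightings G).Nonempty :=
    ⟨0, by simp, by simp, by simp, by simp [subgraphWeight], by simp [subgraphWeight]⟩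
  have husc : UpperSemicontinuousOn (kappaAt G) (thresholdWeightings G) := by
    intro Δ _ y hy
    obtain ⟨S, hS, hm⟩ := (kappaAt_isLeast G hG Δ).1
    have hev : ∀ᶠ Δ' in nhdsWithin Δ (thresholdWeightings G),
        ∀ H : G.Subgraph, H ∈ S → subgraphWeight Δ' H < y := by
      refine Filter.eventually_all.2 fun H => ?_
      by_cases hH : H ∈ S
      · have hlt : subgraphWeight Δ H < y := (hm.2 ⟨H, hH, rfl⟩).trans_lt hy
        filter_upwards [nhdsWithin_le_nhds
          ((continuous_subgraphWeight H).continuousAt.eventually_lt_const hlt)] with Δ' h _ using h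
      · exact Filter.Eventually.of_forall fun _ h => absurd h hH
    filter_upwards [hev] with Δ' h
    obtain ⟨m, hm'⟩ := exists_isGreatest_cost hS Δ'
    obtain ⟨H, hH, rfl⟩ := hm'.1
    exact ((kappaAt_isLeast G hG Δ').2 ⟨S, hS, hm'⟩).trans_lt (h H hH)
  obtain ⟨Δ, hΔ, hmax⟩ := husc.exists_isMaxOn hne (isCompact_thresholdWeightings G)
  have hg : IsGreatest (kappaAt G '' thresholdWeightings G) (kappaAt G Δ) :=
    ⟨⟨Δ, hΔ, rfl⟩, by rintro _ ⟨Δ', hΔ', rfl⟩; exact hmax hΔ'⟩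
  rw [kappa, hg.csSup_eq]
  exact hg

/-! Upper bound on κ, for an arbitrary threshold weighting. Since Δ ≥ 0 on induced subgraphs and α ≤
1, the edges inside a vertex set S have β-weight at most |S|. Split the cube along its cheapest
coordinate, which carries at most a 1/d share of this weight, and recurse in every slice. In the
resulting lexicographic order an initial segment properly cuts only one slice per level, so its cut
weight is a sum of geometric type, of order q^d/d (`exists_rank_cut_le`). As Δ(G) = 0, the cut
weight bounds Δ of the initial segment, and adding edges along the order is a cheap union sequence
(`kappaAt_le_of_cut_le`).

Lower bound on κ: take α = 1 and β constant. Then Δ(H) times the degree is at least the edge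
boundary of V(H). Every union sequence contains some H with between one and two thirds of the
vertices, and the spectral gap bounds its boundary below (`edge_isoperimetry`).

Treewidth: a bag X of a narrow tree decomposition separates off a set U of balanced size. If h(x) is
the number of coordinates in which x can leave U, the sum of √h over U is at least |U|(n -
|U|)/(2n), where n = q^d (`sqrt_isoperimetry`). As h ≤ d and h vanishes on U outside X, X has at
least order n/√d words. Conversely, layering words by the number of letters in the lower half of the
alphabet gives a path decomposition whose bags have binomial size.

On the hypercube the logarithm of the treewidth has order d, so the factor √d between the two
invariants is √(log tw). -/

/-! ### Weights as sums over ordered pairs, and union sequences from vertex orders -/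

open Classical in
theorem two_mul_sum_edgeSet {V : Type*} [Fintype V] {G : SimpleGraph V} (H : G.Subgraph)
    (f : Sym2 V → ℝ) :
    2 * ∑ e ∈ H.edgeSet.toFinset, f e = ∑ x, ∑ y, if H.Adj x y then f s(x, y) else 0 := by
  rw [← Fintype.sum_prod_type' (f := fun x y => if H.Adj x y then f s(x, y) else 0),
    ← Finset.sum_filter,
    ← Finset.sum_fiberwise_of_maps_to (t := H.edgeSet.toFinset) (g := fun p : V × V => s(p.1, p.2)),
    Finset.mul_sum]
  · refine Finset.sum_congr rfl fun e he => ?_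
    induction e using Sym2.ind with
    | _ x y =>
      have hxy : H.Adj x y := by simpa using he
      have hne : x ≠ y := hxy.ne
      have : ({p ∈ {p : V × V | H.Adj p.1 p.2} | s(p.1, p.2) = s(x, y)} : Finset (V × V)) =
          {(x, y), (y, x)} := by
        ext ⟨a, b⟩
        simp only [Finset.mem_filter, Finset.mem_univ, true_and, Sym2.eq_iff, Finset.mem_insert,
          Finset.mem_singleton, Prod.mk.injEq]
        constructor
        · exact fun h => h.2
        · rintro (⟨rfl, rfl⟩ | ⟨rfl, rfl⟩)
          · exact ⟨hxy, Or.inl ⟨rfl, rfl⟩⟩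
          · exact ⟨hxy.symm, Or.inr ⟨rfl, rfl⟩⟩
      rw [this, Finset.sum_pair (by simp [hne])]
      simp only [Sym2.eq_swap (a := y) (b := x)]
      ring
  · rintro ⟨x, y⟩ h
    simpa using h

open Classical in
theorem two_mul_subgraphWeight {V : Type*} [Fintype V] {G : SimpleGraph V}
    (Δ : (V → ℝ) × (Sym2 V → ℝ)) (H : G.Subgraph) :
    2 * subgraphWeight Δ H = 2 * (∑ x, if x ∈ H.verts then Δ.1 x else 0) -
      ∑ x, ∑ y, if H.Adj x y then Δ.2 s(x, y) else 0 := by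
  rw [← two_mul_sum_edgeSet, subgraphWeight, mul_sub, ← Finset.sum_filter]
  congr 3
  ext; simp

/-- The subgraphs that can be built from edges by unions through subgraphs of weight at
most `M`. -/
inductive Constructible {V : Type*} [Fintype V] {G : SimpleGraph V}
    (Δ : (V → ℝ) × (Sym2 V → ℝ)) (M : ℝ) : G.Subgraph → Prop
  | edge {u v : V} (h : G.Adj u v) (hM : subgraphWeight Δ (G.subgraphOfAdj h) ≤ M) :
      Constructible Δ M (G.subgraphOfAdj h)
  | union {A B : G.Subgraph} (hA : Constructible Δ M A) (hB : Constructible Δ M B)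
      (hM : subgraphWeight Δ (A ⊔ B) ≤ M) : Constructible Δ M (A ⊔ B)

theorem BuiltByUnions.append_singleton {V : Type*} {G : SimpleGraph V} {S : List G.Subgraph}
    (hS : BuiltByUnions G S) {H : G.Subgraph}
    (hH : (∃ (u v : V) (h : G.Adj u v), H = G.subgraphOfAdj h) ∨
      (∃ A ∈ S, ∃ B ∈ S, H = A ⊔ B)) : BuiltByUnions G (S ++ [H]) := by
  intro i hi
  simp only [List.length_append, List.length_singleton] at hi
  rcases Nat.lt_succ_iff_lt_or_eq.1 hi with hi' | rfl
  · rcases hS i hi' with h | ⟨j, k, hj, hk, h⟩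
    · left
      simpa [List.getElem_append_left hi'] using h
    · right
      refine ⟨j, k, hj, hk, ?_⟩
      rw [List.getElem_append_left hi', List.getElem_append_left (hj.trans hi'),
        List.getElem_append_left (hk.trans hi'), h]
  · rcases hH with h | ⟨A, hA, B, hB', h⟩
    · left
      simpa using h
    · right
      obtain ⟨j, hj, rfl⟩ := List.getElem_of_mem hA
      obtain ⟨k, hk, rfl⟩ := List.getElem_of_mem hB'
      refine ⟨j, k, hj, hk, ?_⟩
      rw [List.getElem_append_left hj, List.getElem_append_left hk]
      simpa using h

theorem BuiltByUnions.take {V : Type*} {G : SimpleGraph V} {S : List G.Subgraph}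
    (hS : BuiltByUnions G S) (n : ℕ) : BuiltByUnions G (S.take n) := by
  intro i hi
  rw [List.length_take] at hi
  rcases hS i (by omega) with h | ⟨j, k, hj, hk, h⟩
  · left; simpa using h
  · right
    refine ⟨j, k, hj, hk, ?_⟩
    simpa using h

/-- A longest duplicate-free list of this kind with all weights at most M is closed under admissible
extensions, so it contains every constructible subgraph. Cut off right after G, it is a union
sequence. Distinctness and indices thus never have to be tracked in a construction. -/
theorem kappaAt_le_of_constructible {V : Type*} [Fintype V] [Nonempty V] {G : SimpleGraph V}
    (hG : ∀ u, ∃ v, G.Adj u v) {Δ : (V → ℝ) × (Sym2 V → ℝ)} {M : ℝ}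
    (h : Constructible Δ M (⊤ : G.Subgraph)) : kappaAt G Δ ≤ M := by
  classical
  have hfin : {S : List G.Subgraph | S.Nodup ∧ BuiltByUnions G S ∧
      ∀ H ∈ S, subgraphWeight Δ H ≤ M}.Finite := by
    refine (List.finite_length_le G.Subgraph (Fintype.card G.Subgraph)).subset ?_
    rintro S ⟨hS, -⟩
    exact hS.length_le_card
  obtain ⟨S, ⟨hS, hB, hw⟩, hmax⟩ := hfin.exists_maximalFor List.length _
    ⟨[], by simp, fun i hi => by simp at hi, by simp⟩
  have hext : ∀ H : G.Subgraph, ((∃ (u v : V) (h : G.Adj u v), H = G.subgraphOfAdj h) ∨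
      (∃ A ∈ S, ∃ B ∈ S, H = A ⊔ B)) → subgraphWeight Δ H ≤ M → H ∈ S := by
    intro H hH hHM
    by_contra hn
    have := hmax (j := S ++ [H]) ⟨?_, hB.append_singleton hH, ?_⟩ (by simp)
    · simp at this
    · rw [List.nodup_append]
      refine ⟨hS, by simp, ?_⟩
      intro a ha b hb hab
      simp only [List.mem_singleton] at hb
      exact hn (hb ▸ hab ▸ ha)
    · intro A hA
      rcases List.mem_append.1 hA with hA | hA
      · exact hw A hA
      · rw [List.mem_singleton.1 hA]; exact hHM
  have hall : ∀ H : G.Subgraph, Constructible Δ M H → H ∈ S := by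
    intro H hH
    induction hH with
    | edge h hM => exact hext _ (Or.inl ⟨_, _, h, rfl⟩) hM
    | union _ _ hM ihA ihB => exact hext _ (Or.inr ⟨_, ihA, _, ihB, rfl⟩) hM
  obtain ⟨n, hn, hS'⟩ := List.getElem_of_mem (hall ⊤ h)
  have hU : IsUnionSequence G (S.take (n + 1)) := by
    refine ⟨hS.sublist (List.take_sublist _ _), ?_, hB.take _⟩
    rw [List.getLast?_eq_getElem?]
    have : (S.take (n + 1)).length - 1 = n := by
      rw [List.length_take]; omega
    rw [this, List.getElem?_take_of_lt (by omega), List.getElem?_eq_getElem hn, hS']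
  obtain ⟨m, hm⟩ := exists_isGreatest_cost hU Δ
  obtain ⟨H, hH, hHm⟩ := hm.1
  exact ((kappaAt_isLeast G hG Δ).2 ⟨_, hU, hm⟩).trans
    (hHm ▸ hw H (List.mem_of_mem_take hH))

/-- The subgraph spanned by a set of edges. -/
def edgeSubgraph {V : Type*} (G : SimpleGraph V) (F : Set (Sym2 V)) (hF : F ⊆ G.edgeSet) :
    G.Subgraph where
  verts := {x | ∃ e ∈ F, x ∈ e}
  Adj x y := s(x, y) ∈ F
  adj_sub h := hF h
  edge_vert h := ⟨_, h, by simp⟩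
  symm := ⟨fun x y h => by rwa [Sym2.eq_swap]⟩

@[simp]
theorem edgeSet_edgeSubgraph {V : Type*} (G : SimpleGraph V) (F : Set (Sym2 V))
    (hF : F ⊆ G.edgeSet) : (edgeSubgraph G F hF).edgeSet = F := by
  ext e
  induction e using Sym2.ind with
  | _ x y => rfl

theorem edgeSubgraph_edgeSet {V : Type*} (G : SimpleGraph V) (hG : ∀ u, ∃ v, G.Adj u v) :
    edgeSubgraph G G.edgeSet subset_rfl = ⊤ := by
  ext x y
  · simp only [edgeSubgraph, Set.mem_ofPred_eq, SimpleGraph.Subgraph.verts_top, Set.mem_univ,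
      iff_true]
    obtain ⟨v, hv⟩ := hG x
    exact ⟨s(x, v), hv, by simp⟩
  · simp [edgeSubgraph]

theorem edgeSubgraph_insert {V : Type*} (G : SimpleGraph V) (F : Set (Sym2 V))
    (hF : F ⊆ G.edgeSet) {u v : V} (h : G.Adj u v) (hF' : insert s(u, v) F ⊆ G.edgeSet) :
    edgeSubgraph G (insert s(u, v) F) hF' = G.subgraphOfAdj h ⊔ edgeSubgraph G F hF := by
  ext x y
  · simp [edgeSubgraph]
  · simp only [edgeSubgraph, Set.mem_insert_iff, Sym2.eq_iff,
      SimpleGraph.Subgraph.sup_adj, SimpleGraph.subgraphOfAdj_adj, eq_comm (a := u),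
      eq_comm (a := v)]
    tauto

theorem edgeSubgraph_singleton {V : Type*} (G : SimpleGraph V) {u v : V} (h : G.Adj u v)
    (hF : {s(u, v)} ⊆ G.edgeSet) : edgeSubgraph G {s(u, v)} hF = G.subgraphOfAdj h := by
  ext x y
  · simp [edgeSubgraph]
  · simp only [edgeSubgraph, Set.mem_singleton_iff, Sym2.eq_iff,
      SimpleGraph.subgraphOfAdj_adj, eq_comm (a := u),
      eq_comm (a := v)]
    tauto

theorem thresholdWeightings_fst_sum_le {V : Type*} [Fintype V] {G : SimpleGraph V}
    {Δ : (V → ℝ) × (Sym2 V → ℝ)} (hΔ : Δ ∈ thresholdWeightings G) (s : Finset V) :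
    ∑ x ∈ s, Δ.1 x ≤ s.card := by
  refine (Finset.sum_le_card_nsmul s _ 1 fun x _ => (hΔ.1 x).2).trans (by simp)

theorem thresholdWeightings_snd_nonneg {V : Type*} [Fintype V] {G : SimpleGraph V}
    {Δ : (V → ℝ) × (Sym2 V → ℝ)} (hΔ : Δ ∈ thresholdWeightings G) (e : Sym2 V) : 0 ≤ Δ.2 e := by
  by_cases he : e ∈ G.edgeSet
  · exact (hΔ.2.1 e he).1
  · exact (hΔ.2.2.1 e he).ge

theorem two_mul_subgraphWeight_induce {V : Type*} [Fintype V] {G : SimpleGraph V}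
    {Δ : (V → ℝ) × (Sym2 V → ℝ)} (hΔ : Δ ∈ thresholdWeightings G) (p : V → Prop) [DecidablePred p] :
    2 * subgraphWeight Δ ((⊤ : G.Subgraph).induce {x | p x}) =
      2 * (∑ x, if p x then Δ.1 x else 0) -
      ∑ x, ∑ y, if p x ∧ p y then Δ.2 s(x, y) else 0 := by
  classical
  rw [two_mul_subgraphWeight]
  congr 1
  · simp
  refine Finset.sum_congr rfl fun x _ => Finset.sum_congr rfl fun y _ => ?_
  by_cases h : G.Adj x y
  · simp [h]
  · simp [h, hΔ.2.2.1 s(x, y) h]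

/-- The two sides of the cut satisfy Δ(G[p]) + Δ(G[¬p]) - β(cut) = Δ(G) = 0, and Δ(G[¬p]) ≥ 0. A sum
over ordered pairs from p to its complement counts each cut edge once. -/
theorem subgraphWeight_induce_le_cut {V : Type*} [Fintype V] {G : SimpleGraph V}
    {Δ : (V → ℝ) × (Sym2 V → ℝ)} (hΔ : Δ ∈ thresholdWeightings G) (p : V → Prop) [DecidablePred p] :
    subgraphWeight Δ ((⊤ : G.Subgraph).induce {x | p x}) ≤
      ∑ x, ∑ y, if p x ∧ ¬ p y then Δ.2 s(x, y) else 0 := by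
  have h1 := two_mul_subgraphWeight_induce hΔ p
  have h2 := two_mul_subgraphWeight_induce hΔ (fun x => ¬ p x)
  have h3 := two_mul_subgraphWeight_induce hΔ (fun _ => True)
  have h4 := hΔ.2.2.2.1 ((⊤ : G.Subgraph).induce {x | ¬ p x})
  have h5 : subgraphWeight Δ ((⊤ : G.Subgraph).induce {x | True}) = 0 := by
    rw [← hΔ.2.2.2.2]
    congr 1
    ext <;> simp
  have hα : (∑ x, if True then Δ.1 x else 0) =
      (∑ x, if p x then Δ.1 x else 0) + ∑ x, if ¬ p x then Δ.1 x else 0 := by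
    rw [← Finset.sum_add_distrib]
    refine Finset.sum_congr rfl fun x _ => ?_
    by_cases h : p x <;> simp [h]
  have hβ : (∑ x, ∑ y, if True ∧ True then Δ.2 s(x, y) else 0) =
      (∑ x, ∑ y, if p x ∧ p y then Δ.2 s(x, y) else 0) +
      (∑ x, ∑ y, if ¬ p x ∧ ¬ p y then Δ.2 s(x, y) else 0) +
      ((∑ x, ∑ y, if p x ∧ ¬ p y then Δ.2 s(x, y) else 0) +
      ∑ x, ∑ y, if ¬ p x ∧ p y then Δ.2 s(x, y) else 0) := by
    simp only [← Finset.sum_add_distrib]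
    refine Finset.sum_congr rfl fun x _ => Finset.sum_congr rfl fun y _ => ?_
    by_cases h : p x <;> by_cases h' : p y <;> simp [h, h']
  have hsymm : (∑ x, ∑ y, if ¬ p x ∧ p y then Δ.2 s(x, y) else 0) =
      ∑ x, ∑ y, if p x ∧ ¬ p y then Δ.2 s(x, y) else 0 := by
    rw [Finset.sum_comm]
    refine Finset.sum_congr rfl fun x _ => Finset.sum_congr rfl fun y _ => ?_
    simp only [Sym2.eq_swap (a := x), and_comm]
  linarith

/-- Compared with the graph induced on ranks below t, the edges of F reach at most one more vertex,
because r is injective, and it costs at most 1. Further edges only lower the weight. -/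
theorem subgraphWeight_edgeSubgraph_le {V : Type*} [Fintype V] {G : SimpleGraph V}
    {Δ : (V → ℝ) × (Sym2 V → ℝ)} (hΔ : Δ ∈ thresholdWeightings G) {r : V → ℕ}
    (hr : Function.Injective r) (t : ℕ) {F : Set (Sym2 V)} (hF : F ⊆ G.edgeSet)
    (hle : ∀ x y, s(x, y) ∈ F → r x ≤ t)
    (hlt : ∀ x y, G.Adj x y → r x < t → r y < t → s(x, y) ∈ F) :
    subgraphWeight Δ (edgeSubgraph G F hF) ≤
      subgraphWeight Δ ((⊤ : G.Subgraph).induce {x | r x < t}) + 1 := by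
  classical
  have hα : ∑ u ∈ (edgeSubgraph G F hF).verts.toFinset, Δ.1 u ≤
      ∑ u ∈ ((⊤ : G.Subgraph).induce {x | r x < t}).verts.toFinset, Δ.1 u + 1 := by
    have hsub : (edgeSubgraph G F hF).verts.toFinset ⊆
        ((⊤ : G.Subgraph).induce {x | r x < t}).verts.toFinset ∪
          Finset.univ.filter fun x => r x = t := by
      intro x hx
      rw [Set.mem_toFinset] at hx
      obtain ⟨e, he, hxe⟩ := hx
      obtain ⟨y, rfl⟩ := Sym2.mem_iff_exists.1 hxe
      have := hle x y he
      simp only [SimpleGraph.Subgraph.induce_verts, Finset.mem_union, Set.mem_toFinset,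
        Set.mem_ofPred_eq, Finset.mem_filter, Finset.mem_univ, true_and]
      omega
    have hcard : (Finset.univ.filter fun x => r x = t).card ≤ 1 :=
      Finset.card_le_one.2 fun a ha b hb => hr (by simp_all)
    refine (Finset.sum_le_sum_of_subset_of_nonneg hsub fun x _ _ => (hΔ.1 x).1).trans ?_
    have h1 := Finset.sum_union_inter (f := Δ.1)
      (s₁ := ((⊤ : G.Subgraph).induce {x | r x < t}).verts.toFinset)
      (s₂ := Finset.univ.filter fun x => r x = t)
    have h2 := Finset.sum_nonneg fun x (_ : x ∈ ((⊤ : G.Subgraph).induce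
      {x | r x < t}).verts.toFinset ∩ Finset.univ.filter fun x => r x = t) => (hΔ.1 x).1
    have h3 := (thresholdWeightings_fst_sum_le hΔ (Finset.univ.filter fun x => r x = t)).trans
      (Nat.cast_le_one.2 hcard)
    linarith
  have hβ : ∑ e ∈ ((⊤ : G.Subgraph).induce {x | r x < t}).edgeSet.toFinset, Δ.2 e ≤
      ∑ e ∈ (edgeSubgraph G F hF).edgeSet.toFinset, Δ.2 e := by
    refine Finset.sum_le_sum_of_subset_of_nonneg (fun e he => ?_)
      fun e _ _ => thresholdWeightings_snd_nonneg hΔ e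
    induction e using Sym2.ind with
    | _ x y =>
      simp only [Set.mem_toFinset, SimpleGraph.Subgraph.mem_edgeSet,
        SimpleGraph.Subgraph.induce_adj, Set.mem_ofPred_eq, SimpleGraph.Subgraph.top_adj] at he
      rw [Set.mem_toFinset, edgeSet_edgeSubgraph]
      exact hlt x y he.2.2 he.1 he.2.1
  unfold subgraphWeight
  linarith

theorem subgraphWeight_subgraphOfAdj_le {V : Type*} [Fintype V] {G : SimpleGraph V}
    {Δ : (V → ℝ) × (Sym2 V → ℝ)} (hΔ : Δ ∈ thresholdWeightings G) {u v : V} (h : G.Adj u v) :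
    subgraphWeight Δ (G.subgraphOfAdj h) ≤ 2 := by
  classical
  have h1 := thresholdWeightings_fst_sum_le hΔ (G.subgraphOfAdj h).verts.toFinset
  have h2 : ((G.subgraphOfAdj h).verts.toFinset).card ≤ 2 := by
    simpa using Finset.card_le_two (a := u) (b := v)
  have h3 : (0 : ℝ) ≤ ∑ e ∈ (G.subgraphOfAdj h).edgeSet.toFinset, Δ.2 e :=
    Finset.sum_nonneg fun e _ => thresholdWeightings_snd_nonneg hΔ e
  have h4 : (((G.subgraphOfAdj h).verts.toFinset).card : ℝ) ≤ 2 := by exact_mod_cast h2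
  unfold subgraphWeight
  linarith

/-- If every initial segment of a linear order of the vertices has a small cut, then `κ_Δ` is
small. -/
theorem kappaAt_le_of_cut_le {V : Type*} [Fintype V] [Nonempty V] {G : SimpleGraph V}
    (hG : ∀ u, ∃ v, G.Adj u v) {Δ : (V → ℝ) × (Sym2 V → ℝ)} (hΔ : Δ ∈ thresholdWeightings G)
    {r : V → ℕ} (hr : Function.Injective r) {M : ℝ} (hM0 : 0 ≤ M)
    (hM : ∀ t, (∑ x, ∑ y, if r x < t ∧ ¬ r y < t then Δ.2 s(x, y) else 0) ≤ M) :
    kappaAt G Δ ≤ M + 2 := by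
  classical
  refine kappaAt_le_of_constructible hG ?_
  -- Edges are added in the order of their later endpoint, with ties broken arbitrarily. The final 2
  -- in M + 2 pays for a single edge; the partially attached last vertex would need only 1.
  let key : Sym2 V → ℕ := Sym2.lift ⟨fun x y => max (r x) (r y), fun x y => max_comm _ _⟩
  have main : ∀ F : Finset (Sym2 V), ∀ hF : (F : Set (Sym2 V)) ⊆ G.edgeSet, F.Nonempty →
      (∀ e ∈ F, ∀ e' ∈ G.edgeSet, key e' < key e → e' ∈ F) →
      Constructible Δ (M + 2) (edgeSubgraph G F hF) := by
    intro F
    induction F using Finset.strongInduction with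
    | H F ih =>
      intro hF hne hdown
      obtain ⟨e, he, hmax⟩ := F.exists_max_image key hne
      -- With t the largest key in F, closure under smaller keys puts all edges among ranks below t
      -- into F.
      have hw : subgraphWeight Δ (edgeSubgraph G F hF) ≤ M + 2 := by
        have := subgraphWeight_edgeSubgraph_le hΔ hr (key e) hF (fun x y hxy => ?_)
          (fun x y hxy hx hy => ?_)
        · have h1 := subgraphWeight_induce_le_cut hΔ (fun x => r x < key e)
          have h2 := hM (key e)
          linarith
        · exact (le_max_left _ _).trans (hmax _ hxy)
        · exact hdown e he _ hxy (max_lt hx hy)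
      induction e using Sym2.ind with
      | _ u v =>
        have huv : G.Adj u v := hF he
        have hedge : Constructible Δ (M + 2) (G.subgraphOfAdj huv) :=
          .edge huv ((subgraphWeight_subgraphOfAdj_le hΔ huv).trans (by linarith))
        have hins : (F : Set (Sym2 V)) = insert s(u, v) ((F.erase s(u, v) : Finset _) : Set _) := by
          rw [← Finset.coe_insert, Finset.insert_erase he]
        rcases (F.erase s(u, v)).eq_empty_or_nonempty with h0 | h0
        · have hs : (F : Set (Sym2 V)) = {s(u, v)} := by rw [hins, h0]; simp
          have : edgeSubgraph G F hF = G.subgraphOfAdj huv := by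
            rw [← edgeSubgraph_singleton G huv (by simpa using huv)]
            congr
          rwa [this]
        · have hF' : ((F.erase s(u, v) : Finset _) : Set (Sym2 V)) ⊆ G.edgeSet :=
            fun x hx => hF (Finset.mem_of_mem_erase hx)
          have : edgeSubgraph G F hF =
              G.subgraphOfAdj huv ⊔ edgeSubgraph G (F.erase s(u, v) : Finset _) hF' := by
            rw [← edgeSubgraph_insert G _ hF' huv (hins ▸ hF)]
            congr
          rw [this] at hw ⊢
          refine .union hedge (ih _ (Finset.erase_ssubset he) hF' h0 ?_) hw
          intro e he' e' he'' hlt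
          refine Finset.mem_erase.2 ⟨?_, hdown e (Finset.mem_of_mem_erase he') e' he'' hlt⟩
          rintro rfl
          exact absurd (hmax e (Finset.mem_of_mem_erase he')) (by omega)
  have := main G.edgeFinset (by simp) ?_ (fun _ _ e' he' _ => by simpa using he')
  · rw [← edgeSubgraph_edgeSet G hG]
    convert this
    simp
  · obtain ⟨u⟩ := ‹Nonempty V›
    obtain ⟨v, hv⟩ := hG u
    exact ⟨s(u, v), by simpa using hv⟩

/-! ### Upper bound on κ: adaptive lexicographic orders of subcubes -/

/-- The words that agree with `z` outside of the set `F` of coordinates. -/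
def subcube {q d : ℕ} (F : Finset (Fin d)) (z : Fin d → Fin q) : Finset (Fin d → Fin q) :=
  Fintype.piFinset fun i => if i ∈ F then Finset.univ else {z i}

theorem mem_subcube {q d : ℕ} {F : Finset (Fin d)} {z x : Fin d → Fin q} :
    x ∈ subcube F z ↔ ∀ i ∉ F, x i = z i := by
  simp only [subcube, Fintype.mem_piFinset]
  refine forall_congr' fun i => ?_
  by_cases h : i ∈ F <;> simp [h]

theorem card_subcube {q d : ℕ} (F : Finset (Fin d)) (z : Fin d → Fin q) :
    (subcube F z).card = q ^ F.card := by
  rw [subcube, Fintype.card_piFinset]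
  have : ∀ i, (if i ∈ F then (Finset.univ : Finset (Fin q)) else {z i}).card =
      if i ∈ F then q else 1 := fun i => by split_ifs <;> simp
  simp [this]

theorem subcube_erase {q d : ℕ} {F : Finset (Fin d)} {i : Fin d} (hi : i ∈ F)
    (z : Fin d → Fin q) (a : Fin q) :
    subcube (F.erase i) (Function.update z i a) = (subcube F z).filter fun x => x i = a := by
  ext x
  simp only [mem_subcube, Finset.mem_filter, Finset.mem_erase, not_and]
  constructor
  · intro h
    refine ⟨fun j hj => ?_, by simpa using h i (by simp)⟩
    have hji : j ≠ i := by rintro rfl; exact hj hi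
    simpa [hji] using h j fun _ => hj
  · rintro ⟨h, rfl⟩ j hj
    by_cases hji : j = i
    · subst hji; simp
    · simpa [hji] using h j (hj hji)

/-- An edge changes exactly one coordinate, so the weights of the directions in F add up to at most
c, and the cheapest direction is at most the average. -/
theorem exists_coordinate_weight_le {q d : ℕ} {w : (Fin d → Fin q) → (Fin d → Fin q) → ℝ}
    (hw0 : ∀ x y, 0 ≤ w x y) (hw1 : ∀ x y, hammingDist x y ≠ 1 → w x y = 0)
    {S : Finset (Fin d → Fin q)} {F : Finset (Fin d)} (hF : F.Nonempty) {c : ℝ}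
    (hS : ∑ x ∈ S, ∑ y ∈ S, w x y ≤ c) :
    ∃ i ∈ F, (∑ x ∈ S, ∑ y ∈ S, if x i ≠ y i then w x y else 0) ≤ c / F.card := by
  refine Finset.exists_le_of_sum_le hF ?_
  rw [Finset.sum_const, nsmul_eq_mul, mul_div_cancel₀ _ (by simpa using hF.ne_empty)]
  refine le_trans ?_ hS
  rw [Finset.sum_comm]
  refine Finset.sum_le_sum fun x _ => ?_
  rw [Finset.sum_comm]
  refine Finset.sum_le_sum fun y _ => ?_
  by_cases h : hammingDist x y = 1
  · rw [← Finset.sum_filter, Finset.sum_const, nsmul_eq_mul]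
    refine mul_le_of_le_one_left (hw0 x y) ?_
    have : (F.filter fun i => x i ≠ y i).card ≤ hammingDist x y :=
      Finset.card_le_card (Finset.filter_subset_filter _ (Finset.subset_univ _))
    exact_mod_cast this.trans h.le
  · simp [hw1 x y h]

/-- Ordering a subcube lexicographically, with adaptively chosen coordinates, keeps the cuts of
all initial segments small. -/
theorem exists_rank_cut_le {q d : ℕ} (hq : 2 ≤ q) {w : (Fin d → Fin q) → (Fin d → Fin q) → ℝ}
    (hw0 : ∀ x y, 0 ≤ w x y) (hw1 : ∀ x y, hammingDist x y ≠ 1 → w x y = 0)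
    (hw : ∀ S : Finset (Fin d → Fin q), ∑ x ∈ S, ∑ y ∈ S, w x y ≤ 2 * S.card) (k : ℕ) :
    ∀ (F : Finset (Fin d)) (z : Fin d → Fin q), F.card = k →
      ∃ (r : (Fin d → Fin q) → ℕ) (N : ℕ), (∀ x ∈ subcube F z, r x < N) ∧
        Set.InjOn r (subcube F z) ∧
        ∀ t, (∑ x ∈ subcube F z, ∑ y ∈ subcube F z,
          if r x < t ∧ ¬ r y < t then w x y else 0) ≤ 24 * ((q : ℝ) ^ k / (k + 2)) := by
  induction k with
  | zero =>
    intro F z hF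
    rw [Finset.card_eq_zero] at hF
    subst hF
    have hS : subcube ∅ z = {z} := by
      ext x; simp [mem_subcube, funext_iff]
    refine ⟨fun _ => 0, 1, by simp, by simp [hS], fun t => ?_⟩
    rw [hS]
    simp only [Finset.sum_singleton]
    rw [if_neg (by tauto)]
    positivity
  | succ k ih =>
    intro F z hF
    have hFne : F.Nonempty := Finset.card_pos.1 (by omega)
    have hSw := hw (subcube F z)
    rw [card_subcube, hF] at hSw
    obtain ⟨i, hi, hBi⟩ := exists_coordinate_weight_le hw0 hw1 hFne hSw
    have := fun a => ih (F.erase i) (Function.update z i a)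
      (by rw [Finset.card_erase_of_mem hi]; omega)
    choose r N hrN hinj hcut using this
    simp only [subcube_erase hi] at hrN hinj hcut
    set S := subcube F z with hSdef
    -- T exceeds all ranks within the slices, so the new rank compares the letter at i first and
    -- then the rank within the slice.
    set T : ℕ := ∑ a, N a + 1 with hT
    have hrT : ∀ x ∈ S, r (x i) x < T := fun x hx =>
      (hrN (x i) x (by simp [hx])).trans_le
        ((Finset.single_le_sum (f := N) (by simp) (Finset.mem_univ (x i))).trans (by omega))
    refine ⟨fun x => (x i).val * T + r (x i) x, q * T, fun x hx => ?_, fun x hx y hy hxy => ?_,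
      fun t => ?_⟩
    · have h1 := hrT x hx
      have h2 : (x i).val + 1 ≤ q := (x i).isLt
      nlinarith [Nat.mul_le_mul_right T h2]
    · have hx' := hrT x hx
      have hy' := hrT y hy
      simp only at hxy
      have h1 : (x i).val = (y i).val := by
        have : ((x i).val * T + r (x i) x) / T = ((y i).val * T + r (y i) y) / T := by rw [hxy]
        rwa [Nat.add_comm, Nat.add_mul_div_right _ _ (by omega), Nat.div_eq_of_lt hx', zero_add,
          Nat.add_comm, Nat.add_mul_div_right _ _ (by omega), Nat.div_eq_of_lt hy',
          zero_add] at this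
      have h2 : x i = y i := Fin.ext h1
      refine hinj (y i) (by simpa [h2] using hx) (by simpa using hy) ?_
      rw [h1, h2] at hxy
      omega
    -- Writing t = (t / T) * T + t % T, slices with a smaller letter lie wholly below t and those
    -- with a larger letter wholly above. Only the slice of letter t / T is cut, at the height t %
    -- T.
    · have hlt : ∀ x ∈ S, (x i).val * T + r (x i) x < t ↔
          (x i).val < t / T ∨ ((x i).val = t / T ∧ r (x i) x < t % T) := by
        intro x hx
        have hx' := hrT x hx
        have htm := Nat.div_add_mod t T
        have htl := Nat.mod_lt t (show 0 < T by omega)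
        rcases lt_trichotomy (x i).val (t / T) with h | h | h
        · simp only [h, true_or, iff_true]
          have := Nat.mul_le_mul_right T (show (x i).val + 1 ≤ t / T from h)
          nlinarith [Nat.zero_le (t % T)]
        · rw [h]
          simp only [lt_irrefl, false_or, true_and]
          constructor <;> intro <;> nlinarith
        · have h1 : ¬ (x i).val < t / T := by omega
          have h2 : (x i).val ≠ t / T := by omega
          simp only [h1, h2, false_and, or_self, iff_false, not_lt]
          have := Nat.mul_le_mul_right T (Nat.succ_le_of_lt h)
          nlinarith
      have hsecond : (∑ x ∈ S, ∑ y ∈ S, if x i = y i ∧ ((x i).val * T + r (x i) x < t ∧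
          ¬ (y i).val * T + r (y i) y < t) then w x y else 0) ≤ 24 * ((q : ℝ) ^ k / (k + 2)) := by
        by_cases hj : t / T < q
        · refine le_trans ?_ (hcut ⟨t / T, hj⟩ (t % T))
          rw [Finset.sum_filter]
          refine Finset.sum_le_sum fun x hx => ?_
          by_cases hxj : x i = ⟨t / T, hj⟩
          · rw [if_pos hxj, Finset.sum_filter]
            refine Finset.sum_le_sum fun y hy => ?_
            by_cases hyx : x i = y i
            · have hyj : y i = ⟨t / T, hj⟩ := hyx ▸ hxj
              rw [if_pos hyj]
              simp only [hlt x hx, hlt y hy]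
              simp [hyj, hxj]
            · rw [if_neg (fun h => hyx h.1)]
              split_ifs
              · exact hw0 x y
              · exact le_rfl
              · exact le_rfl
          · rw [if_neg hxj]
            refine Finset.sum_nonpos fun y hy => ?_
            rw [if_neg]
            rintro ⟨hxy, h1, h2⟩
            have hne : (x i).val ≠ t / T := fun h => hxj (Fin.ext h)
            rw [hlt x hx] at h1
            rw [hlt y hy, ← hxy] at h2
            omega
        · refine (Finset.sum_nonpos fun x hx => Finset.sum_nonpos fun y hy => ?_).trans
            (by positivity)
          rw [if_neg]
          rintro ⟨hxy, -, h2⟩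
          rw [hlt y hy] at h2
          have := (y i).isLt
          omega
      have hfirst : (∑ x ∈ S, ∑ y ∈ S, if (x i).val * T + r (x i) x < t ∧
          ¬ (y i).val * T + r (y i) y < t then w x y else 0) ≤
          (∑ x ∈ S, ∑ y ∈ S, if x i ≠ y i then w x y else 0) +
          (∑ x ∈ S, ∑ y ∈ S, if x i = y i ∧ ((x i).val * T + r (x i) x < t ∧
          ¬ (y i).val * T + r (y i) y < t) then w x y else 0) := by
        simp only [← Finset.sum_add_distrib]
        refine Finset.sum_le_sum fun x hx => Finset.sum_le_sum fun y hy => ?_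
        have := hw0 x y
        by_cases h : x i = y i
        · simp [h]
        · simp only [h, ne_eq, not_false_eq_true, if_true, false_and, if_false, add_zero]
          split_ifs <;> linarith
      refine hfirst.trans ((add_le_add hBi hsecond).trans ?_)
      rw [hF]
      have hq' : (2 : ℝ) ≤ q := by exact_mod_cast hq
      have hk : (0 : ℝ) ≤ k := k.cast_nonneg
      have hqk : (0 : ℝ) < (q : ℝ) ^ k := by positivity
      push_cast
      rw [pow_succ]
      -- The recurrence divided by q^k. At q = 2, k = 0 it is an equality, which determines 24; with
      -- denominator k + 1 in place of k + 2 in the bound it would fail there for every constant.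
      have key : 2 * (q : ℝ) / (k + 1) + 24 / (k + 2) ≤ 24 * q / (k + 3) := by
        rw [div_add_div _ _ (by positivity) (by positivity),
          div_le_div_iff₀ (by positivity) (by positivity)]
        have : 0 ≤ ((q : ℝ) - 2) * (22 * k ^ 2 + 62 * k + 36) :=
          mul_nonneg (by linarith) (by positivity)
        nlinarith
      calc 2 * ((q : ℝ) ^ k * q) / (k + 1) + 24 * ((q : ℝ) ^ k / (k + 2))
          = (q : ℝ) ^ k * (2 * (q : ℝ) / (k + 1) + 24 / (k + 2)) := by ring
        _ ≤ (q : ℝ) ^ k * (24 * q / (k + 3)) := by gcongr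
        _ = 24 * ((q : ℝ) ^ k * q / (k + 1 + 2)) := by ring

theorem hammingDist_update {q d : ℕ} {x : Fin d → Fin q} {i : Fin d} {a : Fin q} (h : a ≠ x i) :
    hammingDist x (Function.update x i a) = 1 := by
  refine Finset.card_eq_one.2 ⟨i, ?_⟩
  ext j
  by_cases hj : j = i
  · subst hj; simpa using h.symm
  · simp [hj]

theorem exists_hammingGraph_adj {q d : ℕ} (hq : 2 ≤ q) (hd : 1 ≤ d) (x : Fin d → Fin q) :
    ∃ y, (hammingGraph q d).Adj x y := by
  have : Nontrivial (Fin q) := Fin.nontrivial_iff_two_le.2 hq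
  obtain ⟨a, ha⟩ := exists_ne (x ⟨0, hd⟩)
  exact ⟨Function.update x ⟨0, hd⟩ a, hammingDist_update ha⟩

theorem kappa_hammingGraph_le {q d : ℕ} (hq : 2 ≤ q) (hd : 1 ≤ d) :
    kappa (hammingGraph q d) ≤ 26 * ((q : ℝ) ^ d / d) := by
  have : NeZero q := ⟨by omega⟩
  have hG := exists_hammingGraph_adj hq hd
  obtain ⟨Δ, hΔ, hk⟩ := (kappa_isGreatest (hammingGraph q d) hG).1
  rw [← hk]
  have hw1 : ∀ x y : Fin d → Fin q, hammingDist x y ≠ 1 → Δ.2 s(x, y) = 0 :=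
    fun x y h => hΔ.2.2.1 _ h
  -- Ordered pairs count each edge twice, so Δ ≥ 0 on the graph induced on S bounds the sum by
  -- 2α(S).
  have hw : ∀ S : Finset (Fin d → Fin q), ∑ x ∈ S, ∑ y ∈ S, Δ.2 s(x, y) ≤ 2 * S.card := by
    intro S
    have h1 := two_mul_subgraphWeight_induce hΔ (fun x => x ∈ S)
    have h2 := hΔ.2.2.2.1 ((⊤ : (hammingGraph q d).Subgraph).induce {x | x ∈ S})
    have h3 := thresholdWeightings_fst_sum_le hΔ S
    have h4 : (∑ x, if x ∈ S then Δ.1 x else 0) = ∑ x ∈ S, Δ.1 x := by simp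
    have h5 : (∑ x, ∑ y, if x ∈ S ∧ y ∈ S then Δ.2 s(x, y) else 0) =
        ∑ x ∈ S, ∑ y ∈ S, Δ.2 s(x, y) := by
      simp [ite_and]
    linarith
  obtain ⟨r, N, -, hinj, hcut⟩ := exists_rank_cut_le hq
    (fun x y => thresholdWeightings_snd_nonneg hΔ s(x, y)) hw1 hw d Finset.univ (fun _ => 0)
    (by simp)
  have hS : subcube Finset.univ (fun _ : Fin d => (0 : Fin q)) = Finset.univ := by
    ext; simp [mem_subcube]
  rw [hS] at hinj hcut
  have h := kappaAt_le_of_cut_le hG hΔ (by simpa using hinj) (by positivity) hcut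
  refine h.trans ?_
  have hd' : (0 : ℝ) < d := by exact_mod_cast hd
  have h1 : (q : ℝ) ^ d / (d + 2) ≤ (q : ℝ) ^ d / d := by gcongr; linarith
  -- This absorbs the additive 2, whence 26 = 24 + 2.
  have h2 : 1 ≤ (q : ℝ) ^ d / d := by
    rw [one_le_div hd']
    exact_mod_cast (Nat.lt_pow_self hq).le
  linarith

/-! ### Edge and vertex isoperimetry, by induction on the first letter -/

theorem sum_hammingDist_eq_one {q d : ℕ} (x : Fin d → Fin q) (g : (Fin d → Fin q) → ℝ) :
    (∑ y, if hammingDist x y = 1 then g y else 0) =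
      ∑ i, ∑ a, if a ≠ x i then g (Function.update x i a) else 0 := by
  rw [← Fintype.sum_prod_type' (f := fun i a => if a ≠ x i then g (Function.update x i a) else 0),
    ← Finset.sum_filter, ← Finset.sum_filter]
  symm
  refine Finset.sum_bij (fun p _ => Function.update x p.1 p.2) ?_ ?_ ?_ (fun _ _ => rfl)
  · rintro ⟨i, a⟩ h
    simp only [Finset.mem_filter, Finset.mem_univ, true_and] at h ⊢
    exact hammingDist_update h
  · rintro ⟨i, a⟩ ha ⟨j, b⟩ hb h
    simp only [Finset.mem_filter, Finset.mem_univ, true_and] at ha hb h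
    have hij : i = j := by
      by_contra hij
      have := congrFun h i
      rw [Function.update_self, Function.update_of_ne hij] at this
      exact ha this
    subst hij
    have := congrFun h i
    simp only [Function.update_self] at this
    rw [this]
  · intro y hy
    simp only [Finset.mem_filter, Finset.mem_univ, true_and] at hy
    obtain ⟨i, hi⟩ := Finset.card_eq_one.1 hy
    have hi' : ∀ j, x j ≠ y j ↔ j = i := by
      intro j
      have := Finset.ext_iff.1 hi j
      simpa using this
    refine ⟨(i, y i), by simpa using ((hi' i).2 rfl).symm, ?_⟩
    ext j
    by_cases hj : j = i
    · subst hj; simp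
    · have := (hi' j).not.2 hj
      simp only [not_not] at this
      simp [hj, this]

theorem sum_fin_cons {q d : ℕ} (f : (Fin (d + 1) → Fin q) → ℝ) :
    ∑ x, f x = ∑ j, ∑ y, f (Fin.cons j y) := by
  rw [← (Fin.consEquiv fun _ => Fin q).sum_comp, Fintype.sum_prod_type]
  rfl

/-- The words that give a member of `U` when the letter `j` is put in front. -/
def wordSection {q d : ℕ} (U : Finset (Fin (d + 1) → Fin q)) (j : Fin q) :
    Finset (Fin d → Fin q) :=
  Finset.univ.filter fun y => Fin.cons j y ∈ U

@[simp]
theorem mem_wordSection {q d : ℕ} {U : Finset (Fin (d + 1) → Fin q)} {j : Fin q}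
    {y : Fin d → Fin q} : y ∈ wordSection U j ↔ (Fin.cons j y : Fin (d + 1) → Fin q) ∈ U := by
  simp [wordSection]

theorem sum_card_wordSection {q d : ℕ} (U : Finset (Fin (d + 1) → Fin q)) :
    ∑ j, ((wordSection U j).card : ℝ) = U.card := by
  have h := sum_fin_cons fun x => if x ∈ U then (1 : ℝ) else 0
  simp only [Finset.sum_boole] at h
  simpa [wordSection] using h.symm

theorem card_words_le {q d : ℕ} (U : Finset (Fin d → Fin q)) : (U.card : ℝ) ≤ (q : ℝ) ^ d := by
  have := Finset.card_le_univ U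
  simp only [Fintype.card_fun, Fintype.card_fin] at this
  exact_mod_cast this

theorem card_sub_card_le_sdiff {α : Type*} [DecidableEq α] (s t : Finset α) :
    (s.card : ℝ) - t.card ≤ (s \ t).card := by
  have := Finset.le_card_sdiff t s
  have h : s.card ≤ (s \ t).card + t.card := by omega
  have h' : (s.card : ℝ) ≤ (s \ t).card + t.card := by exact_mod_cast h
  linarith

/-- The edge-isoperimetric inequality given by the spectral gap of the Hamming graph. -/
theorem edge_isoperimetry {q d : ℕ} (U : Finset (Fin d → Fin q)) :
    (q : ℝ) * (U.card * ((q : ℝ) ^ d - U.card)) ≤ (q : ℝ) ^ d * ∑ x, ∑ i, ∑ a,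
      if x ∈ U ∧ Function.update x i a ∉ U then (1 : ℝ) else 0 := by
  induction d with
  | zero =>
    have h := Finset.card_le_univ U
    simp only [Fintype.card_fun, Fintype.card_fin, pow_zero] at h
    simp only [Finset.univ_eq_empty, Finset.sum_empty, Finset.sum_const_zero, mul_zero, pow_zero]
    interval_cases h : U.card <;> simp
  | succ d ih =>
    set n : ℝ := (q : ℝ) ^ d with hn
    have hn0 : 0 ≤ n := by positivity
    -- Boundary pairs that change the first letter from j to a are counted by a difference of
    -- sections; the others are boundary pairs inside one section.
    have hsplit : (∑ x, ∑ i, ∑ a, if x ∈ U ∧ Function.update x i a ∉ U then (1 : ℝ) else 0) =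
        ∑ j, ∑ a, ((wordSection U j \ wordSection U a).card : ℝ) +
        ∑ j, ∑ y, ∑ i, ∑ a, if y ∈ wordSection U j ∧ Function.update y i a ∉ wordSection U j
          then (1 : ℝ) else 0 := by
      rw [sum_fin_cons, ← Finset.sum_add_distrib]
      refine Finset.sum_congr rfl fun j _ => ?_
      simp only [Fin.sum_univ_succ, Fin.update_cons_zero, ← Fin.cons_update, mem_wordSection,
        Finset.sum_add_distrib]
      congr 1
      rw [Finset.sum_comm]
      refine Finset.sum_congr rfl fun a _ => ?_
      rw [Finset.sum_boole]
      congr 2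
      ext y
      simp
    -- The difference of two section sizes is at most n in absolute value, and also at most the sum
    -- of the two set differences; the square is bounded by the product.
    have hdiff : ∑ j, ∑ a, ((wordSection U j).card - (wordSection U a).card : ℝ) ^ 2 ≤
        2 * (n * ∑ j, ∑ a, ((wordSection U j \ wordSection U a).card : ℝ)) := by
      have hsymm : ∑ j, ∑ a, ((wordSection U j \ wordSection U a).card : ℝ) =
          ∑ j, ∑ a, ((wordSection U a \ wordSection U j).card : ℝ) := Finset.sum_comm
      rw [two_mul, ← mul_add]
      nth_rewrite 2 [hsymm]
      simp only [← Finset.sum_add_distrib, Finset.mul_sum]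
      refine Finset.sum_le_sum fun j _ => Finset.sum_le_sum fun a _ => ?_
      have h1 := card_sub_card_le_sdiff (wordSection U j) (wordSection U a)
      have h2 := card_sub_card_le_sdiff (wordSection U a) (wordSection U j)
      have h3 := card_words_le (wordSection U j)
      have h4 := card_words_le (wordSection U a)
      have h5 : (0 : ℝ) ≤ (wordSection U j).card := Nat.cast_nonneg _
      have h6 : (0 : ℝ) ≤ (wordSection U a).card := Nat.cast_nonneg _
      have h7 : (0 : ℝ) ≤ (wordSection U j \ wordSection U a).card := Nat.cast_nonneg _
      have h8 : (0 : ℝ) ≤ (wordSection U a \ wordSection U j).card := Nat.cast_nonneg _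
      rw [← sq_abs, sq]
      exact mul_le_mul (abs_le.2 ⟨by linarith, by linarith⟩) (abs_le.2 ⟨by linarith, by linarith⟩)
        (abs_nonneg _) hn0
    have hvar : ∑ j, ∑ a, ((wordSection U j).card - (wordSection U a).card : ℝ) ^ 2 =
        2 * (q * ∑ j, ((wordSection U j).card : ℝ) ^ 2 - (U.card : ℝ) ^ 2) := by
      rw [← sum_card_wordSection]
      simp only [sub_sq, Finset.sum_add_distrib, Finset.sum_sub_distrib, Finset.sum_const,
        Finset.card_univ, Fintype.card_fin, nsmul_eq_mul, ← Finset.mul_sum, ← Finset.sum_mul]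
      ring
    have hsec : (q : ℝ) * (n * U.card - ∑ j, ((wordSection U j).card : ℝ) ^ 2) ≤
        n * ∑ j, ∑ y, ∑ i, ∑ a, if y ∈ wordSection U j ∧ Function.update y i a ∉ wordSection U j
          then (1 : ℝ) else 0 := by
      rw [← sum_card_wordSection, Finset.mul_sum, ← Finset.sum_sub_distrib, Finset.mul_sum,
        Finset.mul_sum]
      refine Finset.sum_le_sum fun j _ => le_trans (le_of_eq ?_) (ih (wordSection U j))
      ring
    rw [hsplit, pow_succ, mul_comm _ (q : ℝ), mul_assoc (q : ℝ)]
    refine mul_le_mul_of_nonneg_left ?_ q.cast_nonneg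
    -- The squares of the section sizes cancel between the variance of the sizes and the inductive
    -- bounds on the sections.
    nlinarith

/-- The number of coordinates in which `x` can be changed to leave `U`. -/
def exitDegree {q d : ℕ} (U : Finset (Fin d → Fin q)) (x : Fin d → Fin q) : ℕ :=
  (Finset.univ.filter fun i => ∃ a, Function.update x i a ∉ U).card

/-- If y is missing from the section of k, then changing the first letter to k leaves U, so the
first coordinate adds one to the exits within the section. -/
theorem exitDegree_cons {q d : ℕ} (U : Finset (Fin (d + 1) → Fin q)) (j k : Fin q)
    (y : Fin d → Fin q) :
    exitDegree (wordSection U j) y + (if y ∈ wordSection U k then 0 else 1) ≤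
      exitDegree U (Fin.cons j y) := by
  simp only [exitDegree, Finset.card_filter, Fin.sum_univ_succ, Fin.update_cons_zero,
    ← Fin.cons_update, mem_wordSection]
  rw [add_comm]
  gcongr
  split_ifs with h1 h2 h2
  · simp
  · simp
  · simp
  · exact absurd ⟨k, h1⟩ h2

/-- This is the triangle inequality for the plane vectors (u i, v i), read as complex numbers. -/
theorem sqrt_sq_sum_add_sq_sum_le {ι : Type*} (s : Finset ι) (u v : ι → ℝ) :
    Real.sqrt ((∑ i ∈ s, u i) ^ 2 + (∑ i ∈ s, v i) ^ 2) ≤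
      ∑ i ∈ s, Real.sqrt (u i ^ 2 + v i ^ 2) := by
  have h := norm_sum_le s fun i => (⟨u i, v i⟩ : ℂ)
  simpa only [Complex.norm_eq_sqrt_sq_add_sq, Complex.re_sum, Complex.im_sum] using h

/-- Quantifies the gain from a perpendicular component: after squaring the left side, the cross term
is at most δ²/8 because B ≤ N/8, and the last square is at most δ²/4 because δ ≤ N. Together they
stay below δ². -/
theorem add_sq_div_le_sqrt {N B S δ D : ℝ} (hN : 0 < N) (hB : 0 ≤ B) (hBN : 8 * B ≤ N) (hBS : B ≤ S)
    (hδ : 0 ≤ δ) (hδN : δ ≤ N) (hδD : δ ≤ D) :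
    B + δ ^ 2 / (2 * N) ≤ Real.sqrt (S ^ 2 + D ^ 2) := by
  apply Real.le_sqrt_of_sq_le
  have h1 : B ^ 2 ≤ S ^ 2 := by gcongr
  have h2 : δ ^ 2 ≤ D ^ 2 := by gcongr
  have h3 : δ ^ 2 / (2 * N) ≤ δ / 2 := by
    rw [div_le_div_iff₀ (by positivity) (by positivity)]
    nlinarith
  have h4 : (δ ^ 2 / (2 * N)) ^ 2 ≤ (δ / 2) ^ 2 := by gcongr
  have h5 : 2 * B * (δ ^ 2 / (2 * N)) ≤ δ ^ 2 / 8 := by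
    rw [mul_div_assoc', div_le_div_iff₀ (by positivity) (by positivity)]
    nlinarith [mul_le_mul_of_nonneg_right hBN (sq_nonneg δ)]
  nlinarith

/-- A Talagrand-type isoperimetric inequality in the Hamming graph. -/
theorem sqrt_isoperimetry {q d : ℕ} (hq : 1 ≤ q) (U : Finset (Fin d → Fin q)) :
    (U.card : ℝ) * ((q : ℝ) ^ d - U.card) / (2 * (q : ℝ) ^ d) ≤
      ∑ x ∈ U, Real.sqrt (exitDegree U x) := by
  induction d with
  | zero =>
    have h := Finset.card_le_univ U
    simp only [Fintype.card_fun, Fintype.card_fin, pow_zero] at h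
    refine le_trans (le_of_eq ?_) (Finset.sum_nonneg fun x _ => Real.sqrt_nonneg _)
    interval_cases h : U.card <;> simp
  | succ d ih =>
    set n : ℝ := (q : ℝ) ^ d with hn
    have hq0 : (0 : ℝ) < q := by exact_mod_cast hq
    have hn0 : 0 < n := by positivity
    have : Nonempty (Fin q) := ⟨⟨0, hq⟩⟩
    -- All sections are compared with the smallest one, so that the differences m j - m k are
    -- nonnegative.
    obtain ⟨k, -, hk⟩ := Finset.univ.exists_min_image (fun j => (wordSection U j).card)
      Finset.univ_nonempty
    set m : Fin q → ℝ := fun j => (wordSection U j).card with hm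
    have hm0 : ∀ j, 0 ≤ m j := fun j => Nat.cast_nonneg _
    have hmn : ∀ j, m j ≤ n := fun j => card_words_le _
    have hmk : ∀ j, m k ≤ m j := fun j => Nat.cast_le.2 (hk j (Finset.mem_univ j))
    -- Each y gives a plane vector: the root of its exit degree in the section, and 1 if y is
    -- missing from section k. Its length is at most the root of the exit degree in U. The first
    -- components sum to at least the inductive bound, the second to at least m j - m k.
    have hsection : ∀ j, m j * (n - m j) / (2 * n) + (m j - m k) ^ 2 / (2 * n) ≤
        ∑ y ∈ wordSection U j, Real.sqrt (exitDegree U (Fin.cons j y)) := by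
      intro j
      have h1 := sqrt_sq_sum_add_sq_sum_le (wordSection U j)
        (fun y => Real.sqrt (exitDegree (wordSection U j) y))
        (fun y => if y ∈ wordSection U k then 0 else 1)
      have h2 : (∑ y ∈ wordSection U j, if y ∈ wordSection U k then (0 : ℝ) else 1) =
          (wordSection U j \ wordSection U k).card := by
        rw [Finset.sdiff_eq_filter, Finset.card_filter]
        push_cast
        refine Finset.sum_congr rfl fun y _ => ?_
        by_cases h : y ∈ wordSection U k <;>
          simp only [h, if_true, if_false, not_true, not_false_iff]
      rw [h2] at h1
      have hB : 0 ≤ m j * (n - m j) / (2 * n) :=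
        div_nonneg (mul_nonneg (hm0 j) (by linarith [hmn j])) (by positivity)
      refine (add_sq_div_le_sqrt hn0 hB ?_ (ih (wordSection U j)) (by linarith [hmk j])
        (by linarith [hmn j, hm0 k]) (card_sub_card_le_sdiff _ _)).trans (h1.trans ?_)
      · rw [mul_div_assoc', div_le_iff₀ (by positivity)]
        nlinarith [sq_nonneg (n - 2 * m j)]
      · refine Finset.sum_le_sum fun y _ => Real.sqrt_le_sqrt ?_
        rw [Real.sq_sqrt (Nat.cast_nonneg _)]
        refine le_trans (le_of_eq ?_) (Nat.cast_le.2 (exitDegree_cons U j k y))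
        push_cast
        split_ifs <;> simp
    have hsum : ∑ x ∈ U, Real.sqrt (exitDegree U x) =
        ∑ j, ∑ y ∈ wordSection U j, Real.sqrt (exitDegree U (Fin.cons j y)) := by
      have h := sum_fin_cons fun x => if x ∈ U then Real.sqrt (exitDegree U x) else 0
      simp only [wordSection, Finset.sum_filter]
      rw [← h]
      simp
    rw [hsum]
    refine le_trans ?_ (Finset.sum_le_sum fun j _ => hsection j)
    have hM : ∑ j, m j = U.card := sum_card_wordSection U
    -- The squares of m j cancel, so the sum depends only on |U| and m k. Its excess over the
    -- claimed bound is a multiple of (|U| - q * m k)².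
    have hexp : ∑ j, (m j * (n - m j) / (2 * n) + (m j - m k) ^ 2 / (2 * n)) =
        ((n - 2 * m k) * U.card + q * m k ^ 2) / (2 * n) := by
      have hc : (q : ℝ) * m k ^ 2 = ∑ _j : Fin q, m k ^ 2 := by simp
      rw [← hM, Finset.mul_sum, hc, ← Finset.sum_add_distrib, Finset.sum_div]
      exact Finset.sum_congr rfl fun j _ => by ring
    rw [hexp, pow_succ, ← hn, div_le_div_iff₀ (by positivity) (by positivity)]
    have : 0 ≤ 2 * n * ((U.card : ℝ) - q * m k) ^ 2 := by positivity
    nlinarith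

/-- If only the words of `X` can leave `U` by a change of one letter then `X` is large. -/
theorem vertex_isoperimetry {q d : ℕ} (hq : 1 ≤ q) {U X : Finset (Fin d → Fin q)}
    (h : ∀ x ∈ U, x ∉ X → ∀ i a, Function.update x i a ∈ U) :
    (U.card : ℝ) * ((q : ℝ) ^ d - U.card) ≤ 2 * (q : ℝ) ^ d * (Real.sqrt d * X.card) := by
  have hq0 : (0 : ℝ) < q := by exact_mod_cast hq
  have h1 := sqrt_isoperimetry hq U
  rw [div_le_iff₀ (by positivity)] at h1
  have h2 : ∑ x ∈ U, Real.sqrt (exitDegree U x) ≤ ∑ x ∈ X, Real.sqrt d := by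
    have h3 : ∑ x ∈ U, Real.sqrt (exitDegree U x) = ∑ x ∈ U ∩ X, Real.sqrt (exitDegree U x) := by
      symm
      refine Finset.sum_subset Finset.inter_subset_left fun x hx hxX => ?_
      have : exitDegree U x = 0 := by
        simp only [exitDegree, Finset.card_eq_zero, Finset.filter_eq_empty_iff, Finset.mem_univ,
          true_implies, not_exists, not_not]
        exact fun i a => h x hx (fun h' => hxX (Finset.mem_inter.2 ⟨hx, h'⟩)) i a
      simp [this]
    rw [h3]
    refine (Finset.sum_le_sum (g := fun _ => Real.sqrt d) fun x _ => Real.sqrt_le_sqrt ?_).trans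
      (Finset.sum_le_sum_of_subset_of_nonneg Finset.inter_subset_right
        fun _ _ _ => Real.sqrt_nonneg _)
    have := Finset.card_le_univ (Finset.univ.filter fun i => ∃ a, Function.update x i a ∉ U)
    rw [Fintype.card_fin] at this
    exact_mod_cast this
  rw [Finset.sum_const, nsmul_eq_mul] at h2
  nlinarith [mul_le_mul_of_nonneg_right h2 (show 0 ≤ 2 * (q : ℝ) ^ d by positivity)]

/-! ### Lower bound on κ: balanced members and the uniform weighting -/

/-- The first member with at least a third of the vertices is a union of two members with less than
a third each, or an edge; for an edge the upper bound needs |V| ≥ 3. This is where the graph with q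
= 2, d = 1 drops out. -/
theorem exists_balanced_of_isUnionSequence {V : Type*} [Fintype V] {G : SimpleGraph V}
    (hV : 3 ≤ Fintype.card V) {S : List G.Subgraph} (hS : IsUnionSequence G S) :
    ∃ H ∈ S, Fintype.card V ≤ 3 * H.verts.ncard ∧ 3 * H.verts.ncard ≤ 2 * Fintype.card V := by
  classical
  have hex : ∃ i, ∃ hi : i < S.length, Fintype.card V ≤ 3 * (S[i]).verts.ncard := by
    obtain ⟨i, hi, h⟩ := List.getElem_of_mem (List.mem_of_getLast? hS.2.1)
    refine ⟨i, hi, ?_⟩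
    rw [h, SimpleGraph.Subgraph.verts_top, Set.ncard_univ, Nat.card_eq_fintype_card]
    omega
  obtain ⟨hi, hle⟩ := Nat.find_spec hex
  refine ⟨_, List.getElem_mem hi, hle, ?_⟩
  rcases hS.2.2 _ hi with ⟨u, v, h, he⟩ | ⟨j, k, hj, hk, he⟩
  · rw [he, SimpleGraph.subgraphOfAdj_verts, Set.ncard_pair h.ne]
    omega
  · have h1 := Nat.find_min hex hj
    have h2 := Nat.find_min hex hk
    simp only [not_exists, not_le] at h1 h2
    have h3 := h1 (hj.trans hi)
    have h4 := h2 (hk.trans hi)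
    have h5 := Set.ncard_union_le (S[j]'(hj.trans hi)).verts (S[k]'(hk.trans hi)).verts
    rw [he, SimpleGraph.Subgraph.verts_sup]
    omega

open Classical in
/-- The threshold weighting of the Hamming graph with unit weights on the vertices and equal
weights on the edges. -/
noncomputable def uniformWeighting (q d : ℕ) :
    ((Fin d → Fin q) → ℝ) × (Sym2 (Fin d → Fin q) → ℝ) :=
  (fun _ => 1, fun e => if e ∈ (hammingGraph q d).edgeSet then 2 / (d * (q - 1) : ℝ) else 0)

theorem degree_hammingGraph {q d : ℕ} (x : Fin d → Fin q) :
    (∑ y, if hammingDist x y = 1 then (1 : ℝ) else 0) = d * (q - 1) := by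
  rw [sum_hammingDist_eq_one x fun _ => 1]
  have : ∀ i, (∑ a, if a ≠ x i then (1 : ℝ) else 0) = q - 1 := by
    intro i
    rw [Finset.sum_boole, Finset.filter_ne', Finset.card_erase_of_mem (Finset.mem_univ _),
      Finset.card_univ, Fintype.card_fin, Nat.cast_pred (Fin.pos (x i))]
  rw [Finset.sum_congr rfl fun i _ => this i]
  simp [mul_sub]

-- Charging half of each edge weight to either endpoint, a vertex of H contributes its degree d(q -
-- 1) minus its degree in H. Nonnegativity of Δ is then evident, and so is the comparison with the
-- edge boundary.
open Classical in
theorem degree_mul_subgraphWeight {q d : ℕ} (hq : 2 ≤ q) (hd : 1 ≤ d)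
    (H : (hammingGraph q d).Subgraph) :
    (d * (q - 1) : ℝ) * subgraphWeight (uniformWeighting q d) H =
      ∑ x, ∑ y, if hammingDist x y = 1 ∧ x ∈ H.verts ∧ ¬ H.Adj x y then (1 : ℝ) else 0 := by
  have hD : (d * (q - 1) : ℝ) ≠ 0 := by
    have h1 : (1 : ℝ) ≤ d := by exact_mod_cast hd
    have h2 : (2 : ℝ) ≤ q := by exact_mod_cast hq
    have : (0 : ℝ) < d * (q - 1) := mul_pos (by linarith) (by linarith)
    exact this.ne'
  have h := two_mul_subgraphWeight (uniformWeighting q d) H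
  have h1 : (d * (q - 1) : ℝ) * subgraphWeight (uniformWeighting q d) H =
      (∑ x, if x ∈ H.verts then (d * (q - 1) : ℝ) else 0) -
        ∑ x, ∑ y, if H.Adj x y then (d * (q - 1) : ℝ) * (2 / (d * (q - 1) : ℝ)) / 2 else 0 := by
    have h2 : (∑ x, ∑ y, if H.Adj x y then (uniformWeighting q d).2 s(x, y) else 0) =
        ∑ x, ∑ y, if H.Adj x y then 2 / (d * (q - 1) : ℝ) else 0 := by
      refine Finset.sum_congr rfl fun x _ => Finset.sum_congr rfl fun y _ => ?_
      by_cases hxy : H.Adj x y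
      · simp [uniformWeighting, hxy, hxy.adj_sub]
      · simp [hxy]
    rw [h2] at h
    have h3 : (∑ x, if x ∈ H.verts then (d * (q - 1) : ℝ) else 0) =
        (d * (q - 1) : ℝ) * ∑ x, if x ∈ H.verts then (uniformWeighting q d).1 x else 0 := by
      rw [Finset.mul_sum]
      exact Finset.sum_congr rfl fun x _ => by simp [uniformWeighting]
    have h4 : (∑ x, ∑ y, if H.Adj x y then (d * (q - 1) : ℝ) * (2 / (d * (q - 1) : ℝ)) / 2 else 0) =
        (d * (q - 1) : ℝ) / 2 * ∑ x, ∑ y, if H.Adj x y then 2 / (d * (q - 1) : ℝ) else 0 := by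
      simp only [Finset.mul_sum]
      refine Finset.sum_congr rfl fun x _ => Finset.sum_congr rfl fun y _ => ?_
      split_ifs <;> ring
    rw [h3, h4]
    linear_combination (d * (q - 1) : ℝ) / 2 * h
  rw [h1, mul_div_cancel₀ _ hD, div_self two_ne_zero, ← Finset.sum_sub_distrib]
  refine Finset.sum_congr rfl fun x _ => ?_
  rw [← degree_hammingGraph x]
  have : (if x ∈ H.verts then ∑ y, if hammingDist x y = 1 then (1 : ℝ) else 0 else 0) =
      ∑ y, if x ∈ H.verts then (if hammingDist x y = 1 then (1 : ℝ) else 0) else 0 := by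
    split_ifs <;> simp
  rw [this, ← Finset.sum_sub_distrib]
  refine Finset.sum_congr rfl fun y _ => ?_
  by_cases hxy : H.Adj x y
  · have h2 : hammingDist x y = 1 := hxy.adj_sub
    simp [hxy, h2, hxy.fst_mem]
  · by_cases hx : x ∈ H.verts <;> simp [hxy, hx]

theorem uniformWeighting_mem {q d : ℕ} (hq : 2 ≤ q) (hd : 1 ≤ d) :
    uniformWeighting q d ∈ thresholdWeightings (hammingGraph q d) := by
  classical
  have h1 : (1 : ℝ) ≤ d := by exact_mod_cast hd
  have h2 : (2 : ℝ) ≤ q := by exact_mod_cast hq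
  have hD : (1 : ℝ) ≤ d * (q - 1) := by nlinarith
  refine ⟨fun u => by simp [uniformWeighting], fun e he => ?_, fun e he => ?_, fun H => ?_, ?_⟩
  · simp only [uniformWeighting, he, if_true]
    exact ⟨by positivity, div_le_self (by norm_num) hD⟩
  · simp [uniformWeighting, he]
  · have h := degree_mul_subgraphWeight hq hd H
    have h0 : (0 : ℝ) ≤ d * (q - 1) * subgraphWeight (uniformWeighting q d) H := by
      rw [h]
      exact Finset.sum_nonneg fun x _ => Finset.sum_nonneg fun y _ => by split_ifs <;> norm_num
    exact nonneg_of_mul_nonneg_right h0 (by linarith)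
  · have h := degree_mul_subgraphWeight hq hd ⊤
    have h0 : (d * (q - 1) : ℝ) * subgraphWeight (uniformWeighting q d)
        (⊤ : (hammingGraph q d).Subgraph) = 0 := by
      rw [h]
      refine Finset.sum_eq_zero fun x _ => Finset.sum_eq_zero fun y _ => ?_
      rw [if_neg]
      rintro ⟨h, -, h'⟩
      exact h' h
    exact (mul_eq_zero.1 h0).resolve_left (by linarith)

theorem le_kappa_hammingGraph {q d : ℕ} (hq : 2 ≤ q) (hd : 1 ≤ d) (hqd : ¬ (q = 2 ∧ d = 1)) :
    2 / 9 * ((q : ℝ) ^ d / d) ≤ kappa (hammingGraph q d) := by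
  classical
  have : NeZero q := ⟨by omega⟩
  have hG := exists_hammingGraph_adj hq hd
  have hΔ := uniformWeighting_mem hq hd
  refine le_trans ?_ ((kappa_isGreatest _ hG).2 ⟨_, hΔ, rfl⟩)
  obtain ⟨S, hS, hm⟩ := (kappaAt_isLeast _ hG (uniformWeighting q d)).1
  have hcard : Fintype.card (Fin d → Fin q) = q ^ d := by simp
  have h3 : 3 ≤ Fintype.card (Fin d → Fin q) := by
    rw [hcard]
    rcases Nat.lt_or_ge q 3 with h | h
    · have hq2 : q = 2 := by omega
      have hd2 : 2 ≤ d := by omega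
      subst hq2
      exact le_trans (by norm_num) (Nat.pow_le_pow_right two_pos hd2)
    · exact h.trans (Nat.le_self_pow (by omega) q)
  obtain ⟨H, hH, hl, hu⟩ := exists_balanced_of_isUnionSequence h3 hS
  refine le_trans ?_ (hm.2 ⟨H, hH, rfl⟩)
  set U := H.verts.toFinset with hU
  rw [Set.ncard_eq_toFinset_card', ← hU, hcard] at hl hu
  set n : ℝ := (q : ℝ) ^ d with hn
  have hl' : n ≤ 3 * U.card := by rw [hn]; exact_mod_cast hl
  have hu' : 3 * U.card ≤ 2 * n := by rw [hn]; exact_mod_cast hu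
  have hd' : (1 : ℝ) ≤ d := by exact_mod_cast hd
  have hq' : (2 : ℝ) ≤ q := by exact_mod_cast hq
  have hn0 : 0 < n := by positivity
  have hiso := edge_isoperimetry U
  -- A pair that leaves the vertex set of H cannot be an edge of H.
  have hbd : (∑ x, ∑ i, ∑ a, if x ∈ U ∧ Function.update x i a ∉ U then (1 : ℝ) else 0) ≤
      d * (q - 1) * subgraphWeight (uniformWeighting q d) H := by
    rw [degree_mul_subgraphWeight hq hd]
    refine Finset.sum_le_sum fun x _ => ?_
    have h := sum_hammingDist_eq_one x fun y => if x ∈ U ∧ y ∉ U then (1 : ℝ) else 0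
    have h' : (∑ i, ∑ a, if a ≠ x i then if x ∈ U ∧ Function.update x i a ∉ U then (1 : ℝ) else 0
        else 0) = ∑ i, ∑ a, if x ∈ U ∧ Function.update x i a ∉ U then (1 : ℝ) else 0 := by
      refine Finset.sum_congr rfl fun i _ => Finset.sum_congr rfl fun a _ => ?_
      by_cases ha : a = x i
      · subst ha
        simp
      · rw [if_pos ha]
    rw [← h', ← h]
    refine Finset.sum_le_sum fun y _ => ?_
    by_cases hy : hammingDist x y = 1
    · by_cases hxy : x ∈ U ∧ y ∉ U
      · have hx : x ∈ H.verts := by simpa [hU] using hxy.1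
        have hA : ¬ H.Adj x y := fun hA => hxy.2 (by simpa [hU] using hA.snd_mem)
        simp [hy, hxy, hx, hA]
      · rw [if_pos hy, if_neg hxy]
        split_ifs <;> norm_num
    · simp [hy]
  -- On the interval from n/3 to 2n/3 the product is smallest at the ends.
  have hprod : 2 / 9 * n ^ 2 ≤ U.card * (n - U.card) := by nlinarith
  set W := subgraphWeight (uniformWeighting q d) H
  have h1 : q * (2 / 9 * n ^ 2) ≤ n * (d * (q - 1) * W) :=
    (mul_le_mul_of_nonneg_left hprod (by linarith)).trans
      (hiso.trans (mul_le_mul_of_nonneg_left hbd hn0.le))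
  have h2 : q * (2 / 9 * n) ≤ (q - 1) * (d * W) := by
    have : n * (q * (2 / 9 * n)) ≤ n * ((q - 1) * (d * W)) := by linarith
    exact le_of_mul_le_mul_left this hn0
  have h3 : (q - 1) * (2 / 9 * n) ≤ (q - 1) * (d * W) := by nlinarith
  have h4 := le_of_mul_le_mul_left h3 (by linarith)
  rw [mul_div_assoc', div_le_iff₀ (by linarith)]
  linarith

/-! ### Balanced separators in tree decompositions, and lower bounds on treewidth -/

namespace TreeDecomposition

variable {V : Type*} {G : SimpleGraph V} (D : TreeDecomposition G)

/-- `A` is a set of nodes other than `t` such that all tree edges that leave `A` lead to `t`. -/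
def IsPocket (t : Fin D.size) (A : Finset (Fin D.size)) : Prop :=
  t ∉ A ∧ ∀ x ∈ A, ∀ y ∉ A, D.tree.Adj x y → y = t

variable {D}

theorem exists_adj_of_mem_of_notMem {v : V} {A : Finset (Fin D.size)} {r s : Fin D.size}
    (hr : v ∈ D.bag r) (hs : v ∈ D.bag s) (hrA : r ∈ A) (hsA : s ∉ A) :
    ∃ x y, x ∈ A ∧ y ∉ A ∧ v ∈ D.bag x ∧ v ∈ D.bag y ∧ D.tree.Adj x y := by
  obtain ⟨p⟩ := (D.connected v).preconnected ⟨r, hr⟩ ⟨s, hs⟩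
  obtain ⟨e, -, h1, h2⟩ := p.exists_boundary_dart {x | x.1 ∈ A} hrA hsA
  exact ⟨e.fst.1, e.snd.1, h1, h2, e.fst.2, e.snd.2, e.adj⟩

theorem exists_mem_bag (D : TreeDecomposition G) (v : V) : ∃ t, v ∈ D.bag t := by
  obtain ⟨t⟩ := (D.connected v).nonempty
  exact ⟨t.1, t.2⟩

/-- If A induces a connected subgraph of the tree, acyclicity leaves a single edge from A to t, and
its end x in A serves as the new exit. Otherwise a component of A splits off. -/
theorem IsPocket.exists_split_or {t : Fin D.size} {A : Finset (Fin D.size)} (h : D.IsPocket t A)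
    (hA : A.Nonempty) :
    (∃ B ⊂ A, B.Nonempty ∧ (∀ x ∈ B, ∀ y ∈ A \ B, ¬ D.tree.Adj x y)) ∨
      ∃ x ∈ A, D.IsPocket x (A.erase x) := by
  classical
  by_cases hc : (D.tree.induce (A : Set (Fin D.size))).Preconnected
  · right
    obtain ⟨a, ha⟩ := hA
    obtain ⟨p⟩ := D.isTree.connected.preconnected a t
    obtain ⟨e, -, h1, h2⟩ := p.exists_boundary_dart (A : Set (Fin D.size)) ha h.1
    have het : D.tree.Adj e.fst t := by
      have := h.2 _ h1 _ h2 e.adj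
      rw [← this]; exact e.adj
    refine ⟨e.fst, h1, by simp, fun z hz y hy hzy => ?_⟩
    by_contra hyx
    have hyA : y ∉ A := fun hyA => hy (Finset.mem_erase.2 ⟨hyx, hyA⟩)
    have hzA := Finset.mem_of_mem_erase hz
    have hyt := h.2 z hzA y hyA hzy
    subst hyt
    -- A second edge from A to t would give two paths between its end z and `e.fst`: one inside A
    -- and one through t, which is not in A.
    obtain ⟨p, hp⟩ := (hc ⟨e.fst, h1⟩ ⟨z, hzA⟩).exists_isPath
    let f := (SimpleGraph.Embedding.induce (G := D.tree) (A : Set (Fin D.size))).toHom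
    have hp' := hp.map (f := f) Subtype.val_injective
    let r : D.tree.Walk e.fst z := .cons het (.cons hzy.symm .nil)
    have hr : r.IsPath := by
      have h3 : e.fst ≠ z := fun h => Finset.ne_of_mem_erase hz h.symm
      simp [r, SimpleGraph.Walk.cons_isPath_iff, het.ne, hzy.ne.symm, h3]
    have heq := (D.isTree.isAcyclic.subsingleton_path _ _).elim ⟨p.map f, hp'⟩ ⟨r, hr⟩
    have hmem : y ∈ (p.map f).support := by
      have : p.map f = r := congrArg Subtype.val heq
      rw [this]
      change y ∈ e.fst :: (SimpleGraph.Walk.cons hzy.symm .nil).support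
      exact List.mem_cons_of_mem _ (SimpleGraph.Walk.start_mem_support _)
    rw [SimpleGraph.Walk.support_map, List.mem_map] at hmem
    obtain ⟨w, -, hw⟩ := hmem
    exact h.1 (hw ▸ w.2)
  · left
    simp only [SimpleGraph.Preconnected, not_forall] at hc
    obtain ⟨u, v, huv⟩ := hc
    refine ⟨A.filter fun x => ∃ hx : x ∈ A, (D.tree.induce (A : Set (Fin D.size))).Reachable u
      ⟨x, hx⟩, ?_, ⟨u.1, ?_⟩, ?_⟩
    · refine Finset.filter_ssubset.2 ⟨v.1, v.2, ?_⟩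
      rintro ⟨_, hv⟩
      exact huv hv
    · simp
    · intro x hx y hy hxy
      simp only [Finset.mem_filter, Finset.mem_sdiff, not_and, not_exists] at hx hy
      obtain ⟨-, hxA, hx⟩ := hx
      refine hy.2 hy.1 hy.1 (hx.trans (SimpleGraph.Adj.reachable ?_))
      exact hxy

theorem card_bag_le_sup (D : TreeDecomposition G) (t : Fin D.size) :
    (D.bag t).card ≤ Finset.univ.sup fun t => (D.bag t).card :=
  Finset.le_sup (f := fun t => (D.bag t).card) (Finset.mem_univ t)

variable [Fintype V] [DecidableEq V]

variable (D) in
/-- The vertices whose nodes all lie in `A`. -/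
def inside (A : Finset (Fin D.size)) : Finset V :=
  Finset.univ.filter fun v => ∀ s, v ∈ D.bag s → s ∈ A

theorem mem_inside {A : Finset (Fin D.size)} {v : V} :
    v ∈ D.inside A ↔ ∀ s, v ∈ D.bag s → s ∈ A := by
  simp [inside]

/-- The nodes of a vertex are connected and can leave A only through t. Hence the bag of t separates
the vertices inside A from the rest. -/
theorem IsPocket.mem_inside_or {t : Fin D.size} {A : Finset (Fin D.size)} (h : D.IsPocket t A)
    {r : Fin D.size} (hr : r ∈ A) {v : V} (hv : v ∈ D.bag r) : v ∈ D.inside A ∨ v ∈ D.bag t := by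
  by_contra! hc
  rw [mem_inside] at hc
  push Not at hc
  obtain ⟨⟨s, hs, hsA⟩, ht⟩ := hc
  obtain ⟨x, y, hx, hy, -, hvy, hxy⟩ := exists_adj_of_mem_of_notMem hv hs hr hsA
  exact ht (h.2 x hx y hy hxy ▸ hvy)

theorem inside_subset_of_not_adj {A B : Finset (Fin D.size)}
    (h : ∀ x ∈ B, ∀ y ∈ A \ B, ¬ D.tree.Adj x y) :
    D.inside A ⊆ D.inside B ∪ D.inside (A \ B) := by
  intro v hv
  by_contra hc
  simp only [Finset.mem_union, mem_inside, not_or, not_forall] at hc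
  obtain ⟨⟨s, hs, hsB⟩, ⟨r, hr, hrB⟩⟩ := hc
  rw [mem_inside] at hv
  have hrB' : r ∈ B := by
    by_contra h'
    exact hrB (Finset.mem_sdiff.2 ⟨hv r hr, h'⟩)
  obtain ⟨x, y, hx, hy, -, hvy, hxy⟩ := exists_adj_of_mem_of_notMem hr hs hrB' hsB
  exact h x hx y (Finset.mem_sdiff.2 ⟨hv y hvy, hy⟩) hxy

theorem inside_subset_erase (A : Finset (Fin D.size)) (x : Fin D.size) :
    D.inside A ⊆ D.inside (A.erase x) ∪ D.bag x := by
  intro v hv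
  rw [mem_inside] at hv
  by_cases hx : v ∈ D.bag x
  · exact Finset.mem_union_right _ hx
  · refine Finset.mem_union_left _ (mem_inside.2 fun s hs => Finset.mem_erase.2 ⟨?_, hv s hs⟩)
    rintro rfl
    exact hx hs

/-- A minimal pocket that contains at least `m` vertices of the graph. -/
theorem exists_isPocket (D : TreeDecomposition G) {m : ℕ} (hm : 1 ≤ m)
    (hV : m + (Finset.univ.sup fun t => (D.bag t).card) ≤ Fintype.card V) :
    ∃ t A, D.IsPocket t A ∧ m ≤ (D.inside A).card ∧ ((D.inside A).card + 2 ≤ 2 * m ∨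
      ∃ x ∈ A, D.IsPocket x (A.erase x) ∧ (D.inside (A.erase x)).card < m) := by
  classical
  -- All nodes but one form a pocket, and it misses at most one bag of vertices; so a pocket with
  -- the fewest nodes can be chosen.
  have hex : ∃ k t A, D.IsPocket t A ∧ m ≤ (D.inside A).card ∧ A.card = k := by
    obtain ⟨t⟩ := D.isTree.connected.nonempty
    refine ⟨_, t, Finset.univ.erase t, ⟨by simp, fun x _ y hy _ => by simpa using hy⟩, ?_, rfl⟩
    have h1 := Finset.card_le_card (inside_subset_erase (D := D) Finset.univ t)
    have h2 : D.inside Finset.univ = Finset.univ := by ext; simp [mem_inside]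
    have h3 := Finset.card_union_le (D.inside (Finset.univ.erase t)) (D.bag t)
    have h4 := D.card_bag_le_sup t
    rw [h2, Finset.card_univ] at h1
    omega
  obtain ⟨t, A, hA, hmA, hk⟩ := Nat.find_spec hex
  have hmin : ∀ s B, D.IsPocket s B → B.card < A.card → (D.inside B).card < m := by
    intro s B hB hlt
    rw [hk] at hlt
    have := Nat.find_min hex hlt
    by_contra hc
    exact this ⟨s, B, hB, not_lt.1 hc, rfl⟩
  refine ⟨t, A, hA, hmA, ?_⟩
  have hne : A.Nonempty := by
    obtain ⟨v, hv⟩ := Finset.card_pos.1 (hm.trans hmA)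
    obtain ⟨s, hs⟩ := D.exists_mem_bag v
    exact ⟨s, mem_inside.1 hv s hs⟩
  -- By minimality both halves of a split hold at most m - 1 vertices each. If A does not split,
  -- moving the exit to x gives a smaller pocket.
  rcases hA.exists_split_or hne with ⟨B, hBA, hB, hadj⟩ | ⟨x, hx, hpx⟩
  · left
    have h1 : D.IsPocket t B := by
      refine ⟨fun h => hA.1 (hBA.1 h), fun x hx y hy hxy => ?_⟩
      refine hA.2 x (hBA.1 hx) y (fun hyA => ?_) hxy
      exact hadj x hx y (Finset.mem_sdiff.2 ⟨hyA, hy⟩) hxy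
    have h2 : D.IsPocket t (A \ B) := by
      refine ⟨fun h => hA.1 (Finset.mem_sdiff.1 h).1, fun x hx y hy hxy => ?_⟩
      refine hA.2 x (Finset.mem_sdiff.1 hx).1 y (fun hyA => ?_) hxy
      have hyB : y ∈ B := by
        by_contra h
        exact hy (Finset.mem_sdiff.2 ⟨hyA, h⟩)
      exact hadj y hyB x hx hxy.symm
    have h3 := hmin t B h1 (Finset.card_lt_card hBA)
    have h4 := hmin t (A \ B) h2 (Finset.card_lt_card (Finset.sdiff_ssubset hBA.1 hB))
    have h5 := (Finset.card_le_card (inside_subset_of_not_adj hadj)).trans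
      (Finset.card_union_le _ _)
    omega
  · right
    exact ⟨x, hx, hpx, hmin x _ hpx (Finset.card_lt_card (Finset.erase_ssubset hx))⟩

end TreeDecomposition

theorem exists_width_eq_treewidth {V : Type*} [Fintype V] (G : SimpleGraph V) :
    ∃ D : TreeDecomposition G, D.width = treewidth G := by
  obtain ⟨D₀⟩ := treeDecomposition_nonempty G
  exact Nat.sInf_mem (s := Set.range fun D : TreeDecomposition G => D.width) ⟨_, D₀, rfl⟩

/-- The treewidth is at least the minimum degree. -/
theorem le_treewidth_of_degree {V : Type*} [Fintype V] [Nonempty V] {G : SimpleGraph V} {k : ℕ}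
    (hk : ∀ v, ∃ N : Finset V, N.card = k ∧ ∀ u ∈ N, G.Adj v u) : k ≤ treewidth G := by
  classical
  obtain ⟨D, hD⟩ := exists_width_eq_treewidth G
  rw [← hD, TreeDecomposition.width]
  suffices h : k + 1 ≤ Finset.univ.sup fun t => (D.bag t).card by omega
  have hcard : ∀ v, ∃ N : Finset V, N.card = k + 1 ∧ ∀ u ∈ N, u = v ∨ G.Adj v u := by
    intro v
    obtain ⟨N, hN, hadj⟩ := hk v
    refine ⟨insert v N, ?_, fun u hu => ?_⟩
    · rw [Finset.card_insert_of_notMem fun h => (hadj v h).ne rfl, hN]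
    · rcases Finset.mem_insert.1 hu with h | h
      · exact Or.inl h
      · exact Or.inr (hadj u h)
  rcases Nat.lt_or_ge (Finset.univ.sup fun t => (D.bag t).card) (Fintype.card V) with hlt | hge
  -- With m = 1 the first alternative is absurd, and in the second nothing is inside A without x. A
  -- vertex v inside A therefore has its whole closed neighbourhood in the bag of x.
  · obtain ⟨t, A, -, hA, h⟩ := D.exists_isPocket le_rfl (by omega)
    rcases h with h | ⟨x, hx, hpx, h0⟩
    · omega
    · obtain ⟨v, hv⟩ := Finset.card_pos.1 hA
      rw [Nat.lt_one_iff, Finset.card_eq_zero] at h0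
      obtain ⟨N, hN, hadj⟩ := hcard v
      rw [← hN]
      refine (Finset.card_le_card fun u hu => ?_).trans (D.card_bag_le_sup x)
      have hshare : ∃ s, v ∈ D.bag s ∧ u ∈ D.bag s := by
        rcases hadj u hu with rfl | h
        · obtain ⟨s, hs⟩ := D.exists_mem_bag u
          exact ⟨s, hs, hs⟩
        · exact D.edge_mem v u h
      obtain ⟨s, hvs, hus⟩ := hshare
      by_cases hsx : s = x
      · exact hsx ▸ hus
      · have hsA := Finset.mem_erase.2 ⟨hsx, TreeDecomposition.mem_inside.1 hv s hvs⟩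
        rcases hpx.mem_inside_or hsA hus with h | h
        · rw [h0] at h
          simp at h
        · exact h
  · obtain ⟨v⟩ := ‹Nonempty V›
    obtain ⟨N, hN, -⟩ := hcard v
    have := Finset.card_le_univ N
    omega

theorem le_treewidth_hammingGraph_of_degree {q d : ℕ} (hq : 1 ≤ q) :
    d * (q - 1) ≤ treewidth (hammingGraph q d) := by
  have : Nonempty (Fin q) := ⟨⟨0, hq⟩⟩
  refine le_treewidth_of_degree fun v =>
    ⟨Finset.univ.filter fun y => hammingDist v y = 1, ?_, fun u hu => (Finset.mem_filter.1 hu).2⟩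
  have h := degree_hammingGraph v
  rw [Finset.sum_boole] at h
  have h' : ((d * (q - 1) : ℕ) : ℝ) = d * (q - 1) := by
    rw [Nat.cast_mul, Nat.cast_pred hq]
  rw [← h'] at h
  exact_mod_cast h

theorem le_treewidth_hammingGraph {q d : ℕ} (hq : 2 ≤ q) (hd : 1 ≤ d) :
    1 / 24 * ((q : ℝ) ^ d / Real.sqrt d) ≤ treewidth (hammingGraph q d) := by
  have hdeg : 1 ≤ treewidth (hammingGraph q d) :=
    le_trans (by nlinarith [Nat.sub_add_cancel (one_le_two.trans hq)])
      (le_treewidth_hammingGraph_of_degree (d := d) (one_le_two.trans hq))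
  obtain ⟨D, hD⟩ := exists_width_eq_treewidth (hammingGraph q d)
  rw [← hD, TreeDecomposition.width] at hdeg ⊢
  set w := Finset.univ.sup fun t => (D.bag t).card with hw
  have hcard : Fintype.card (Fin d → Fin q) = q ^ d := by simp
  have hsd : 1 ≤ Real.sqrt d := by
    rw [Real.one_le_sqrt]
    exact_mod_cast hd
  have hn0 : (0 : ℝ) < (q : ℝ) ^ d := by
    have : 0 < q := by omega
    positivity
  have hmain : (q : ℝ) ^ d ≤ 12 * (Real.sqrt d * w) := by
    rcases Nat.lt_or_ge (12 * w) (q ^ d) with hlt | hge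
    -- Here m is n/3 rounded up, with n = q^d. Adding bags of at most n/12 words keeps U between n/3
    -- and 3n/4, where |U|(n - |U|) ≥ n²/6.
    · obtain ⟨t, A, hA, hmA, h⟩ := D.exists_isPocket (m := (q ^ d + 2) / 3) (by omega)
        (by rw [hcard]; omega)
      have hI : (D.inside A).card + w ≤ 2 * ((q ^ d + 2) / 3) - 2 + w ∨
          (D.inside A).card + w ≤ (q ^ d + 2) / 3 + 2 * w := by
        rcases h with h | ⟨x, -, -, h⟩
        · left; omega
        · right
          have h1 := (Finset.card_le_card
            (TreeDecomposition.inside_subset_erase (D := D) A x)).trans (Finset.card_union_le _ _)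
          have h2 := D.card_bag_le_sup x
          omega
      have hXw := D.card_bag_le_sup t
      set U := D.inside A ∪ D.bag t with hU
      have hUI : (D.inside A).card ≤ U.card := Finset.card_le_card Finset.subset_union_left
      have hUw : U.card ≤ (D.inside A).card + (D.bag t).card := Finset.card_union_le _ _
      have hiso := vertex_isoperimetry (one_le_two.trans hq) (U := U) (X := D.bag t) (by
        intro x hx hxt i a
        by_cases ha : a = x i
        · subst ha; simpa using hx
        · have hxI : x ∈ D.inside A := (Finset.mem_union.1 hx).resolve_right hxt
          obtain ⟨s, hs, hs'⟩ := D.edge_mem x (Function.update x i a) (hammingDist_update ha)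
          exact Finset.mem_union.2
            (hA.mem_inside_or (TreeDecomposition.mem_inside.1 hxI s hs) hs'))
      have hl : q ^ d ≤ 3 * U.card := by omega
      have hu : 4 * U.card ≤ 3 * q ^ d := by omega
      have hl' : (q : ℝ) ^ d ≤ 3 * U.card := by exact_mod_cast hl
      have hu' : 4 * (U.card : ℝ) ≤ 3 * (q : ℝ) ^ d := by exact_mod_cast hu
      have hXw' : ((D.bag t).card : ℝ) ≤ w := by exact_mod_cast hXw
      set n : ℝ := (q : ℝ) ^ d
      have hprod : 1 / 6 * n ^ 2 ≤ U.card * (n - U.card) := by nlinarith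
      have h1 : Real.sqrt d * (D.bag t).card ≤ Real.sqrt d * w := by gcongr
      have h2 : n * n ≤ n * (12 * (Real.sqrt d * w)) := by
        nlinarith [mul_le_mul_of_nonneg_left h1 hn0.le]
      exact le_of_mul_le_mul_left h2 hn0
    · have h1 : (q : ℝ) ^ d ≤ 12 * w := by exact_mod_cast hge
      have h2 : (w : ℝ) ≤ Real.sqrt d * w := le_mul_of_one_le_left w.cast_nonneg hsd
      linarith
  -- The width is at least 1, so passing from bag size to width costs at most a factor 2: 24 = 2 *
  -- 12.
  have hw2 : (w : ℝ) ≤ 2 * ((w - 1 : ℕ) : ℝ) := by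
    have : w ≤ 2 * (w - 1) := by omega
    exact_mod_cast this
  rw [mul_div_assoc', div_le_iff₀ (by linarith)]
  nlinarith

/-! ### Upper bound on treewidth: layers of binomial size -/

/-- Any walk from the vertices up to u to those beyond u uses the edge from u to u + 1, so every
edge is a bridge. -/
theorem isTree_pathGraph (n : ℕ) : (SimpleGraph.pathGraph (n + 1)).IsTree := by
  refine ⟨SimpleGraph.pathGraph_connected n, SimpleGraph.isAcyclic_iff_forall_adj_isBridge.2 ?_⟩
  have key : ∀ u v : Fin (n + 1), u.val + 1 = v.val →
      (SimpleGraph.pathGraph (n + 1)).IsBridge s(u, v) := by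
    intro u v huv
    rw [SimpleGraph.isBridge_iff]
    rintro ⟨p⟩
    obtain ⟨e, -, h1, h2⟩ := p.exists_boundary_dart {x | x.val ≤ u.val} (by simp)
      (by simp only [Set.mem_ofPred_eq]; omega)
    simp only [Set.mem_ofPred_eq, not_le] at h1 h2
    have hadj := e.adj
    rw [SimpleGraph.deleteEdges_adj, SimpleGraph.pathGraph_adj] at hadj
    refine hadj.2 ?_
    have h3 : e.fst = u := Fin.ext (by omega)
    have h4 : e.snd = v := Fin.ext (by omega)
    rw [h3, h4]
    rfl
  intro u v huv
  rcases SimpleGraph.pathGraph_adj.1 huv with h | h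
  · exact key u v h
  · rw [Sym2.eq_swap]
    exact key v u h

/-- A graph whose vertices are layered so that edges stay within a layer or join consecutive layers
has treewidth at most twice the size of the largest layer. -/
theorem treewidth_le_of_layers {V : Type*} [Fintype V] {G : SimpleGraph V} {f : V → ℕ} {m L : ℕ}
    (hf : ∀ v, f v ≤ m) (hadj : ∀ u v, G.Adj u v → f u ≤ f v + 1)
    (hL : ∀ k, (Finset.univ.filter fun v => f v = k).card ≤ L) : treewidth G ≤ 2 * L := by
  classical
  -- A path decomposition with two consecutive layers per bag. A vertex of layer k lies only in bag
  -- k and, for k > 0, in the adjacent bag k - 1.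
  let D : TreeDecomposition G :=
    { size := m + 1
      tree := SimpleGraph.pathGraph (m + 1)
      isTree := isTree_pathGraph m
      bag := fun t => Finset.univ.filter fun v => f v = t.val ∨ f v = t.val + 1
      edge_mem := by
        intro u v huv
        have h1 := hadj u v huv
        have h2 := hadj v u huv.symm
        refine ⟨⟨min (f u) (f v), by have := hf u; omega⟩, ?_, ?_⟩ <;>
          simp only [Finset.mem_filter, Finset.mem_univ, true_and] <;> omega
      connected := by
        intro v
        have hmem : ∀ t : Fin (m + 1), (v ∈ Finset.univ.filter fun v => f v = t.val ∨
            f v = t.val + 1) ↔ f v = t.val ∨ f v = t.val + 1 := by simp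
        have h0 : f v < m + 1 := Nat.lt_succ_of_le (hf v)
        rw [SimpleGraph.connected_iff_exists_forall_reachable]
        refine ⟨⟨⟨f v, h0⟩, by simp⟩, ?_⟩
        rintro ⟨t, ht⟩
        rcases (hmem t).1 ht with h | h
        · have : t = ⟨f v, h0⟩ := Fin.ext h.symm
          subst this
          exact SimpleGraph.Reachable.refl _
        · refine SimpleGraph.Adj.reachable ?_
          change (SimpleGraph.pathGraph (m + 1)).Adj ⟨f v, h0⟩ t
          exact SimpleGraph.pathGraph_adj.2 (Or.inr h.symm) }
  have hD : treewidth G ≤ D.width := Nat.sInf_le ⟨D, rfl⟩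
  refine hD.trans ((Nat.sub_le _ _).trans (Finset.sup_le fun t _ => ?_))
  have h : D.bag t ⊆ (Finset.univ.filter fun v => f v = t.val) ∪
      Finset.univ.filter fun v => f v = t.val + 1 := by
    intro v hv
    simpa [D] using hv
  have h1 := (Finset.card_le_card h).trans (Finset.card_union_le _ _)
  have h2 := hL t.val
  have h3 := hL (t.val + 1)
  omega

/-- The number of letters of `x` that are smaller than `a`. -/
def smallLetters {q d : ℕ} (a : ℕ) (x : Fin d → Fin q) : Finset (Fin d) :=
  Finset.univ.filter fun i => (x i).val < a

theorem card_smallLetters_eq {q d a b : ℕ} (hab : a + b = q) (k : ℕ) :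
    (Finset.univ.filter fun x : Fin d → Fin q => (smallLetters a x).card = k).card =
      d.choose k * (a ^ k * b ^ (d - k)) := by
  have hfib : ∀ T : Finset (Fin d), (Finset.univ.filter fun x : Fin d → Fin q =>
      smallLetters a x = T).card = a ^ T.card * b ^ (d - T.card) := by
    intro T
    have : (Finset.univ.filter fun x : Fin d → Fin q => smallLetters a x = T) =
        Fintype.piFinset fun i => if i ∈ T then Finset.univ.filter fun j : Fin q => j.val < a
          else Finset.univ.filter fun j : Fin q => ¬ j.val < a := by
      ext x
      simp only [Finset.mem_filter, Finset.mem_univ, true_and, Fintype.mem_piFinset,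
        Finset.ext_iff, smallLetters]
      refine forall_congr' fun i => ?_
      by_cases hi : i ∈ T <;> simp [hi]
    have ha : (Finset.univ.filter fun j : Fin q => j.val < a).card = a := by
      rw [Fin.card_filter_val_lt]
      omega
    have hb : (Finset.univ.filter fun j : Fin q => ¬ j.val < a).card = b := by
      have := Finset.card_filter_add_card_filter_not (s := Finset.univ)
        (fun j : Fin q => j.val < a)
      rw [ha, Finset.card_univ, Fintype.card_fin] at this
      omega
    rw [this, Fintype.card_piFinset]
    have hc : ∀ i, (if i ∈ T then Finset.univ.filter fun j : Fin q => j.val < a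
          else Finset.univ.filter fun j : Fin q => ¬ j.val < a).card = if i ∈ T then a else b := by
      intro i
      by_cases hi : i ∈ T
      · rw [if_pos hi, if_pos hi, ha]
      · rw [if_neg hi, if_neg hi, hb]
    rw [Finset.prod_congr rfl fun i _ => hc i, Finset.prod_ite, Finset.prod_const,
      Finset.prod_const, Finset.filter_mem_eq_inter, Finset.univ_inter,
      ← Finset.compl_filter, Finset.card_compl, Fintype.card_fin,
      Finset.filter_mem_eq_inter, Finset.univ_inter]
  rw [Finset.card_eq_sum_card_fiberwise (f := fun x => smallLetters a x)
    (t := Finset.powersetCard k Finset.univ)]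
  · rw [Finset.sum_congr rfl (g := fun _ => a ^ k * b ^ (d - k)), Finset.sum_const,
      Finset.card_powersetCard, Finset.card_univ, Fintype.card_fin, smul_eq_mul]
    intro T hT
    have hTk := (Finset.mem_powersetCard.1 hT).2
    rw [← hTk, ← hfib T, Finset.filter_filter]
    congr 1
    ext x
    simp only [Finset.mem_filter, Finset.mem_univ, true_and, and_iff_right_iff_imp]
    rintro rfl
    rfl
  · intro x hx
    simpa [Finset.mem_powersetCard] using hx

/-- The recurrence of the central binomial coefficients reduces the induction step to (2n + 1)(2n +
3) ≤ (2n + 2)². -/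
theorem two_mul_add_one_mul_centralBinom_sq_le (n : ℕ) :
    (2 * n + 1) * n.centralBinom ^ 2 ≤ 16 ^ n := by
  induction n with
  | zero => simp
  | succ n ih =>
    have h := Nat.succ_mul_centralBinom_succ n
    have h1 : (n + 1) ^ 2 * ((2 * (n + 1) + 1) * (n + 1).centralBinom ^ 2) ≤
        (n + 1) ^ 2 * 16 ^ (n + 1) := by
      calc (n + 1) ^ 2 * ((2 * (n + 1) + 1) * (n + 1).centralBinom ^ 2)
          = (2 * n + 3) * ((n + 1) * (n + 1).centralBinom) ^ 2 := by ring
        _ = 4 * ((2 * n + 3) * (2 * n + 1)) * ((2 * n + 1) * n.centralBinom ^ 2) := by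
            rw [h]; ring
        _ ≤ 4 * (4 * (n + 1) ^ 2) * 16 ^ n := by
            refine Nat.mul_le_mul (Nat.mul_le_mul_left 4 ?_) ih
            nlinarith
        _ = (n + 1) ^ 2 * 16 ^ (n + 1) := by ring
    exact Nat.le_of_mul_le_mul_left h1 (by positivity)

/-- For odd m = 2n + 1 the middle coefficient is half of the central one of 2n + 2. -/
theorem add_one_mul_choose_sq_le (m k : ℕ) : (m + 1) * m.choose k ^ 2 ≤ 4 ^ m := by
  rcases Nat.even_or_odd' m with ⟨n, rfl | rfl⟩
  · calc (2 * n + 1) * (2 * n).choose k ^ 2 ≤ (2 * n + 1) * n.centralBinom ^ 2 := by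
          gcongr; exact Nat.choose_le_centralBinom k n
      _ ≤ 16 ^ n := two_mul_add_one_mul_centralBinom_sq_le n
      _ = 4 ^ (2 * n) := by rw [pow_mul]; norm_num
  · have h1 : (2 * n + 1).choose k ≤ (2 * n + 1).choose n := by
      have := Nat.choose_le_middle k (2 * n + 1)
      rwa [show (2 * n + 1) / 2 = n by omega] at this
    have h2 : 2 * (2 * n + 1).choose n = (n + 1).centralBinom := by
      rw [Nat.centralBinom_eq_two_mul_choose, show 2 * (n + 1) = 2 * n + 1 + 1 by ring,
        Nat.choose_succ_succ, Nat.choose_symm_half]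
      ring
    have h3 := two_mul_add_one_mul_centralBinom_sq_le (n + 1)
    have h4 : 4 * ((2 * n + 1 + 1) * (2 * n + 1).choose k ^ 2) ≤ 4 * 4 ^ (2 * n + 1) := by
      calc 4 * ((2 * n + 1 + 1) * (2 * n + 1).choose k ^ 2)
          ≤ 4 * ((2 * (n + 1) + 1) * (2 * n + 1).choose n ^ 2) := by gcongr; omega
        _ = (2 * (n + 1) + 1) * (n + 1).centralBinom ^ 2 := by rw [← h2]; ring
        _ ≤ 16 ^ (n + 1) := h3
        _ = 4 * 4 ^ (2 * n + 1) := by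
            rw [show (16 : ℕ) = 4 ^ 2 by norm_num, ← pow_mul]; ring
    omega

/-- For odd q the two halves of the alphabet differ by one middle letter. Condition on the number m
of positions without a middle letter: the number of small letters is then binomial with parameter
1/2, which reduces the biased case to the symmetric one. -/
theorem choose_mul_pow_eq_sum (d k : ℕ) (a e : ℝ) :
    d.choose k * (a ^ k * (a + e) ^ (d - k)) =
      ∑ m ∈ Finset.range (d + 1), (d.choose m * (2 * a) ^ m * e ^ (d - m)) *
        (m.choose k / 2 ^ m) := by
  rcases Nat.lt_or_ge d k with h | h
  · rw [Nat.choose_eq_zero_of_lt h]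
    symm
    rw [Nat.cast_zero, zero_mul]
    refine Finset.sum_eq_zero fun m hm => ?_
    rw [Nat.choose_eq_zero_of_lt (n := m) (by have := Finset.mem_range.1 hm; omega)]
    simp
  · obtain ⟨l, rfl⟩ := Nat.exists_eq_add_of_le h
    rw [show k + l + 1 = k + (l + 1) by ring, Finset.sum_range_add, Finset.sum_eq_zero, zero_add,
      Nat.add_sub_cancel_left, add_pow, Finset.mul_sum, Finset.mul_sum]
    · refine Finset.sum_congr rfl fun m hm => ?_
      have h1 : (k + l).choose (k + m) * (k + m).choose k = (k + l).choose k * l.choose m := by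
        rw [Nat.choose_mul (by omega), Nat.add_sub_cancel_left, Nat.add_sub_cancel_left]
      have h2 : ((k + l).choose (k + m) : ℝ) * (k + m).choose k =
          (k + l).choose k * l.choose m := by exact_mod_cast h1
      rw [mul_pow, show k + l - (k + m) = l - m by omega, pow_add a]
      field_simp
      linear_combination (-(a ^ k * a ^ m * e ^ (l - m))) * h2
    · intro m hm
      rw [Nat.choose_eq_zero_of_lt (n := m) (Finset.mem_range.1 hm)]
      simp

/-- Up to normalisation, this is the mean of 1/(m + 1) under a binomial law. Absorbing the
denominator into the coefficient gives the expansion of the right side without its constant term in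
x. -/
theorem sum_choose_mul_pow_div_le (d : ℕ) {x e : ℝ} (he : 0 ≤ e) :
    (d + 1) * x * ∑ m ∈ Finset.range (d + 1), (d.choose m * x ^ m * e ^ (d - m)) / (m + 1) ≤
      (x + e) ^ (d + 1) := by
  rw [add_pow, Finset.sum_range_succ' _ (d + 1), Finset.mul_sum]
  refine le_trans (le_of_eq (Finset.sum_congr rfl fun m _ => ?_))
    (le_add_of_nonneg_right (by positivity))
  have h1 : ((d : ℝ) + 1) * d.choose m = (d + 1).choose (m + 1) * (m + 1) := by
    exact_mod_cast Nat.add_one_mul_choose_eq d m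
  rw [Nat.add_sub_add_right, pow_succ]
  field_simp
  linear_combination (x * x ^ m * e ^ (d - m)) * h1

theorem layer_card_sq_le {q d a e : ℕ} (ha : 1 ≤ a) (he : e ≤ 1) (hq : 2 * a + e = q) (k : ℕ) :
    2 * (d + 1) * ((d.choose k * (a ^ k * (a + e) ^ (d - k)) : ℕ) : ℝ) ^ 2 ≤
      3 * ((q : ℝ) ^ d) ^ 2 := by
  have ha' : (1 : ℝ) ≤ a := by exact_mod_cast ha
  have he' : (e : ℝ) ≤ 1 := by exact_mod_cast he
  have he0 : (0 : ℝ) ≤ e := e.cast_nonneg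
  have hq' : 2 * (a : ℝ) + e = q := by exact_mod_cast hq
  push_cast
  rw [choose_mul_pow_eq_sum]
  set w : ℕ → ℝ := fun m => d.choose m * (2 * (a : ℝ)) ^ m * (e : ℝ) ^ (d - m) with hw
  have hw0 : ∀ m, 0 ≤ w m := fun m => by positivity
  have hsum : ∑ m ∈ Finset.range (d + 1), w m = (q : ℝ) ^ d := by
    rw [← hq', add_pow]
    exact Finset.sum_congr rfl fun m _ => by ring
  -- Cauchy–Schwarz with weights w replaces the conditional probabilities by their squares, each at
  -- most 1/(m + 1).
  have hcs := Finset.sum_sq_le_sum_mul_sum_of_sq_le_mul (Finset.range (d + 1))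
    (r := fun m => w m * (m.choose k / 2 ^ m)) (f := w)
    (g := fun m => w m * (m.choose k / 2 ^ m) ^ 2) (fun m _ => hw0 m)
    (fun m _ => mul_nonneg (hw0 m) (sq_nonneg _)) (fun m _ => le_of_eq (by ring))
  have hle : ∑ m ∈ Finset.range (d + 1), w m * ((m.choose k : ℝ) / 2 ^ m) ^ 2 ≤
      ∑ m ∈ Finset.range (d + 1), w m / (m + 1) := by
    refine Finset.sum_le_sum fun m _ => ?_
    rw [div_eq_mul_inv (w m)]
    refine mul_le_mul_of_nonneg_left ?_ (hw0 m)
    have h1 : ((m : ℝ) + 1) * m.choose k ^ 2 ≤ 4 ^ m := by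
      exact_mod_cast add_one_mul_choose_sq_le m k
    rw [div_pow, ← pow_mul, mul_comm m, pow_mul, ← one_div,
      div_le_div_iff₀ (by positivity) (by positivity)]
    norm_num
    linarith
  have hmain := sum_choose_mul_pow_div_le d (x := 2 * (a : ℝ)) (e := e) he0
  rw [hq'] at hmain
  rw [hsum] at hcs
  set Z := ∑ m ∈ Finset.range (d + 1), w m / (m + 1) with hZ
  set N := ∑ m ∈ Finset.range (d + 1), w m * ((m.choose k : ℝ) / 2 ^ m) with hN
  have hqd : (0 : ℝ) ≤ (q : ℝ) ^ d := by positivity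
  have h1 : N ^ 2 ≤ (q : ℝ) ^ d * Z := hcs.trans (mul_le_mul_of_nonneg_left hle hqd)
  -- From e ≤ 1 ≤ a comes q ≤ 3a, the source of the constant 3.
  have h2 : (d + 1) * (2 * (a : ℝ)) * Z ≤ (q : ℝ) ^ d * (3 * a) :=
    hmain.trans (by rw [pow_succ]; gcongr; linarith)
  have h3 : (a : ℝ) * (2 * (d + 1) * Z) ≤ a * (3 * (q : ℝ) ^ d) := by linarith
  have h4 := le_of_mul_le_mul_left h3 (by linarith)
  calc 2 * (d + 1) * N ^ 2 ≤ 2 * (d + 1) * ((q : ℝ) ^ d * Z) := by gcongr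
    _ = (q : ℝ) ^ d * (2 * (d + 1) * Z) := by ring
    _ ≤ (q : ℝ) ^ d * (3 * (q : ℝ) ^ d) := by gcongr
    _ = 3 * ((q : ℝ) ^ d) ^ 2 := by ring

theorem smallLetters_card_le_of_adj {q d a : ℕ} {x y : Fin d → Fin q}
    (h : (hammingGraph q d).Adj x y) :
    (smallLetters a x).card ≤ (smallLetters a y).card + 1 := by
  have hxy : hammingDist x y = 1 := h
  have hsub : smallLetters a x ⊆ smallLetters a y ∪ Finset.univ.filter fun i => x i ≠ y i := by
    intro i hi
    simp only [smallLetters, Finset.mem_union, Finset.mem_filter, Finset.mem_univ,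
      true_and] at hi ⊢
    by_cases hxy : x i = y i
    · left; rwa [← hxy]
    · right; exact hxy
  have h1 := (Finset.card_le_card hsub).trans (Finset.card_union_le _ _)
  have h2 : (Finset.univ.filter fun i => x i ≠ y i).card = 1 := hxy
  omega

theorem treewidth_hammingGraph_le {q d : ℕ} (hq : 2 ≤ q) (hd : 1 ≤ d) :
    (treewidth (hammingGraph q d) : ℝ) ≤ 3 * ((q : ℝ) ^ d / Real.sqrt d) := by
  have hd' : (0 : ℝ) < d := by exact_mod_cast hd
  have hsd : 0 < Real.sqrt d := Real.sqrt_pos.2 hd'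
  set L := ⌊3 / 2 * ((q : ℝ) ^ d / Real.sqrt d)⌋₊ with hL
  have hlayer : ∀ k, (Finset.univ.filter fun x : Fin d → Fin q =>
      (smallLetters (q / 2) x).card = k).card ≤ L := by
    intro k
    apply Nat.le_floor
    rw [card_smallLetters_eq (b := q / 2 + q % 2) (by omega)]
    have h := layer_card_sq_le (d := d) (q := q) (a := q / 2) (e := q % 2) (by omega) (by omega)
      (by omega) k
    set N : ℝ := ((d.choose k * ((q / 2) ^ k * (q / 2 + q % 2) ^ (d - k)) : ℕ) : ℝ)
    have hN : 0 ≤ N := Nat.cast_nonneg _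
    rw [mul_div_assoc', le_div_iff₀ hsd]
    apply le_of_sq_le_sq _ (by positivity)
    rw [mul_pow, Real.sq_sqrt hd'.le]
    nlinarith [sq_nonneg N, sq_nonneg ((q : ℝ) ^ d)]
  have h := treewidth_le_of_layers (G := hammingGraph q d)
    (f := fun x => (smallLetters (q / 2) x).card)
    (m := d) (fun x => by simpa using Finset.card_le_univ (smallLetters (q / 2) x))
    (fun x y hxy => smallLetters_card_le_of_adj hxy) hlayer
  have h1 : (treewidth (hammingGraph q d) : ℝ) ≤ 2 * L := by exact_mod_cast h
  have h2 : (L : ℝ) ≤ 3 / 2 * ((q : ℝ) ^ d / Real.sqrt d) := Nat.floor_le (by positivity)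
  linarith

/-! ### Comparison of κ and treewidth on the hypercube -/

theorem log_treewidth_hypercube {d : ℕ} (hd : 2 ≤ d) :
    (d : ℝ) / 28 ≤ Real.log (treewidth (hammingGraph 2 d)) ∧
      Real.log (treewidth (hammingGraph 2 d)) ≤ 2 * d := by
  have hl := le_treewidth_hammingGraph (q := 2) le_rfl (one_le_two.trans hd)
  have hu := treewidth_hammingGraph_le (q := 2) le_rfl (one_le_two.trans hd)
  have hT2 : 2 ≤ treewidth (hammingGraph 2 d) := by
    have := le_treewidth_hammingGraph_of_degree (q := 2) (d := d) one_le_two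
    omega
  set T : ℝ := (treewidth (hammingGraph 2 d) : ℝ)
  have hT : (2 : ℝ) ≤ T := Nat.ofNat_le_cast.2 hT2
  have hd' : (2 : ℝ) ≤ d := by exact_mod_cast hd
  have hsd : 1 ≤ Real.sqrt d := Real.one_le_sqrt.2 (by linarith)
  have hs2 : Real.sqrt d ^ 2 = d := Real.sq_sqrt (by linarith)
  have hdn : (d : ℝ) ≤ 2 ^ d := by exact_mod_cast (Nat.lt_two_pow_self (n := d)).le
  have hlog2 := Real.log_two_gt_d9
  have hlog2' := Real.log_two_lt_d9
  push_cast at hl hu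
  constructor
  -- For small d the bound 2^d/(24√d) may be below 1 and its logarithm useless. Since T ≥ 2, the
  -- constant 24 is absorbed into T^6 instead; squaring and d ≤ 2^d then give 2^d ≤ T^14.
  · have h1 : (2 : ℝ) ^ d ≤ T ^ 7 * Real.sqrt d := by
      rw [mul_div_assoc', div_le_iff₀ (by linarith)] at hl
      have h6 : (24 : ℝ) ≤ T ^ 6 := le_trans (by norm_num) (pow_le_pow_left₀ (by norm_num) hT 6)
      calc (2 : ℝ) ^ d ≤ 24 * (T * Real.sqrt d) := by linarith
        _ ≤ T ^ 6 * (T * Real.sqrt d) := by gcongr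
        _ = T ^ 7 * Real.sqrt d := by ring
    have h2 : (2 : ℝ) ^ d * 2 ^ d ≤ T ^ 14 * 2 ^ d := by
      calc (2 : ℝ) ^ d * 2 ^ d = (2 ^ d) ^ 2 := by ring
        _ ≤ (T ^ 7 * Real.sqrt d) ^ 2 := by gcongr
        _ = T ^ 14 * d := by rw [mul_pow, hs2]; ring
        _ ≤ T ^ 14 * 2 ^ d := by gcongr
    have h3 := Real.log_le_log (by positivity) (le_of_mul_le_mul_right h2 (by positivity))
    rw [Real.log_pow, Real.log_pow] at h3
    push_cast at h3
    nlinarith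
  · have h1 : T ≤ 2 ^ (2 * d) := by
      calc T ≤ 3 * (2 ^ d / Real.sqrt d) := hu
        _ ≤ 3 * 2 ^ d := by gcongr; exact div_le_self (by positivity) hsd
        _ ≤ 2 ^ d * 2 ^ d := by
            gcongr
            have : (2 : ℝ) ^ 2 ≤ 2 ^ d := pow_le_pow_right₀ one_le_two hd
            linarith
        _ = 2 ^ (2 * d) := by rw [two_mul, pow_add]
    have h2 := Real.log_le_log (by linarith) h1
    rw [Real.log_pow] at h2
    push_cast at h2
    nlinarith

/-- Compares 26 * 2^d/d with 2^d/(24√d); 624 = 26 * 24. Both the upper bound in terms of treewidth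
and the separation follow from it. -/
theorem kappa_hypercube_le_treewidth {d : ℕ} (hd : 1 ≤ d) :
    kappa (hammingGraph 2 d) * Real.sqrt d ≤ 624 * treewidth (hammingGraph 2 d) := by
  have hl := le_treewidth_hammingGraph (q := 2) le_rfl hd
  have hk := kappa_hammingGraph_le (q := 2) le_rfl hd
  have hd' : (0 : ℝ) < d := by exact_mod_cast hd
  have hsd : 0 < Real.sqrt d := Real.sqrt_pos.2 hd'
  have h1 := mul_le_mul_of_nonneg_right hk hsd.le
  have h2 : 26 * (((2 : ℕ) : ℝ) ^ d / d) * Real.sqrt d =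
      26 * (((2 : ℕ) : ℝ) ^ d / Real.sqrt d) := by
    have h3 := Real.mul_self_sqrt hd'.le
    field_simp
    linear_combination h3
  linarith

theorem kappa_hypercube_bounds {d : ℕ} (hd : 2 ≤ d) :
    1 / 81 * ((treewidth (hammingGraph 2 d) : ℝ) /
        Real.sqrt (Real.log (treewidth (hammingGraph 2 d) : ℝ))) ≤ kappa (hammingGraph 2 d) ∧
      kappa (hammingGraph 2 d) ≤ 1248 * ((treewidth (hammingGraph 2 d) : ℝ) /
        Real.sqrt (Real.log (treewidth (hammingGraph 2 d) : ℝ))) := by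
  have hd1 : 1 ≤ d := one_le_two.trans hd
  obtain ⟨hlog1, hlog2⟩ := log_treewidth_hypercube hd
  have hu := treewidth_hammingGraph_le (q := 2) le_rfl hd1
  have hk := le_kappa_hammingGraph (q := 2) le_rfl hd1 (by omega)
  have hkT := kappa_hypercube_le_treewidth hd1
  set T : ℝ := (treewidth (hammingGraph 2 d) : ℝ)
  set n : ℝ := ((2 : ℕ) : ℝ) ^ d
  have hn : 0 ≤ n := by positivity
  have hT : 0 ≤ T := Nat.cast_nonneg _
  have hd' : (0 : ℝ) < d := by exact_mod_cast hd1
  have hsd : 0 < Real.sqrt d := Real.sqrt_pos.2 hd'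
  have hs2 : Real.sqrt d ^ 2 = d := Real.sq_sqrt hd'.le
  have h1 : Real.sqrt d / 6 ≤ Real.sqrt (Real.log T) := by
    apply Real.le_sqrt_of_sq_le
    rw [div_pow, hs2]
    linarith
  have h2 : Real.sqrt (Real.log T) ≤ 2 * Real.sqrt d := by
    apply Real.sqrt_le_iff.2
    refine ⟨by positivity, ?_⟩
    rw [mul_pow, hs2]
    linarith
  have hs : 0 < Real.sqrt (Real.log T) := lt_of_lt_of_le (by positivity) h1
  -- The constants are 81 = (9/2) * 3 * 6 and 1248 = 624 * 2, where 6 and 2 come from √d/6 ≤ √(log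
  -- T) ≤ 2√d.
  constructor
  · refine le_trans ?_ hk
    rw [mul_div_assoc', mul_div_assoc', div_le_div_iff₀ hs hd']
    rw [mul_div_assoc', le_div_iff₀ hsd] at hu
    have h3 : T * d ≤ 3 * n * Real.sqrt d := by
      calc T * d = T * Real.sqrt d * Real.sqrt d := by rw [mul_assoc, ← sq, hs2]
        _ ≤ 3 * n * Real.sqrt d := by gcongr
    have h4 := mul_le_mul_of_nonneg_left h1 hn
    linarith
  · rw [mul_div_assoc', le_div_iff₀ hs]
    have hk0 : 0 ≤ kappa (hammingGraph 2 d) := le_trans (by positivity) hk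
    nlinarith [mul_le_mul_of_nonneg_left h2 hk0]

theorem kappa_hypercube_isLittleO :
    (fun d : ℕ => kappa (hammingGraph 2 d)) =o[Filter.atTop]
      fun d : ℕ => (treewidth (hammingGraph 2 d) : ℝ) := by
  rw [Asymptotics.isLittleO_iff]
  intro c hc
  have hlim : Filter.Tendsto (fun d : ℕ => Real.sqrt d) Filter.atTop Filter.atTop :=
    Real.tendsto_sqrt_atTop.comp tendsto_natCast_atTop_atTop
  filter_upwards [hlim.eventually_ge_atTop (624 / c), Filter.eventually_ge_atTop 2] with d h1 hd
  have hk := le_kappa_hammingGraph (q := 2) le_rfl (one_le_two.trans hd) (by omega)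
  have hk0 : 0 ≤ kappa (hammingGraph 2 d) := le_trans (by positivity) hk
  rw [Real.norm_of_nonneg hk0, Real.norm_of_nonneg (Nat.cast_nonneg _)]
  have h2 := kappa_hypercube_le_treewidth (one_le_two.trans hd)
  have h3 : kappa (hammingGraph 2 d) * (624 / c) ≤ 624 * treewidth (hammingGraph 2 d) :=
    (mul_le_mul_of_nonneg_left h1 hk0).trans h2
  rw [mul_div_assoc', div_le_iff₀ hc] at h3
  linarith

theorem mainTheorem1 :
    (∃ c C : ℝ, 0 < c ∧ 0 < C ∧ ∀ q d : ℕ, 2 ≤ q → 1 ≤ d →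
      kappa (hammingGraph q d) ≤ C * ((q : ℝ) ^ d / d) ∧
      (¬(q = 2 ∧ d = 1) → c * ((q : ℝ) ^ d / d) ≤ kappa (hammingGraph q d))) ∧
    (∃ c C : ℝ, 0 < c ∧ 0 < C ∧ ∀ q d : ℕ, 2 ≤ q → 1 ≤ d →
      c * ((q : ℝ) ^ d / Real.sqrt d) ≤ (treewidth (hammingGraph q d) : ℝ) ∧
      (treewidth (hammingGraph q d) : ℝ) ≤ C * ((q : ℝ) ^ d / Real.sqrt d)) ∧
    (∃ c C : ℝ, 0 < c ∧ 0 < C ∧ ∀ d : ℕ, 2 ≤ d →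
      c * ((treewidth (hammingGraph 2 d) : ℝ) /
          Real.sqrt (Real.log (treewidth (hammingGraph 2 d) : ℝ))) ≤
        kappa (hammingGraph 2 d) ∧
      kappa (hammingGraph 2 d) ≤
        C * ((treewidth (hammingGraph 2 d) : ℝ) /
          Real.sqrt (Real.log (treewidth (hammingGraph 2 d) : ℝ)))) ∧
    ((fun d : ℕ => kappa (hammingGraph 2 d)) =o[Filter.atTop]
      fun d : ℕ => (treewidth (hammingGraph 2 d) : ℝ)) := by
  refine ⟨⟨2 / 9, 26, by norm_num, by norm_num, fun q d hq hd =>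
      ⟨kappa_hammingGraph_le hq hd, le_kappa_hammingGraph hq hd⟩⟩,
    ⟨1 / 24, 3, by norm_num, by norm_num, fun q d hq hd =>
      ⟨le_treewidth_hammingGraph hq hd, treewidth_hammingGraph_le hq hd⟩⟩,
    ⟨1 / 81, 1248, by norm_num, by norm_num, fun d hd => kappa_hypercube_bounds hd⟩,
    kappa_hypercube_isLittleO⟩
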